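/- Let $M$ be a smooth manifold of dimension $d\neq 1$ and let $E\to M$ be an exact Courant algebroid with scalar product $\langle\cdot,\cdot\rangle$, anchor $\pi$ and Dorfman bracket $[\cdot,\cdot]$. Let $\mathcal G$ be a semi-Riemannian generalised metric on $E$, i.e. a smooth symmetric bilinear form $\mathcal G=\langle \mathcal G^{\mathrm{end}}\cdot,\cdot\rangle$ with $(\mathcal G^{\mathrm{end}})^2=1$ whose restriction to $T^*M\cong\ker\pi$ is nondegenerate; let $E_\pm$ be the $\pm1$-eigenbundles of $\mathcal G^{\mathrm{end}}$, so that $\pi:E_\pm\to TM$ are isomorphisms. Let $g$ be the semi-Riemannian metric on $M$ with $g(\pi a,\pi b)=\langle a,b\rangle$ for $a,b\in E_+$ (then $g(\pi a,\pi b)=-\langle a,b\rangle$ for $a,b\in E_-$), $\nabla$ its Levi-Civita connection, $s=\tfrac12\big((\pi|_{E_+})^{-1}+(\pi|_{E_-})^{-1}\big):TM\to E$, and $H$ the three-form $H(X,Y,Z)=2\langle[sX,sY],sZ\rangle$. (In the identification $E\cong TM\oplus T^*M$ given by $s$, $\langle X+\xi,Y+\eta\rangle=\tfrac12(\xi(Y)+\eta(X))$,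 $E_\pm=\{X\pm gX\}$ and $[X+\xi,Y+\eta]=[X,Y]+\mathcal L_X\eta-\iota_Yd\xi+H(X,Y,\cdot)$.) Put $\mathrm{Rm}(X,Y,Z,W)=g(R(X,Y)W,Z)$ with $R(X,Y)=[\nabla_X,\nabla_Y]-\nabla_{[X,Y]}$, and let $H^{(2)}(X,Y,Z,W)$ be the $g$-contraction of $H(X,Y,\cdot)$ with $H(Z,W,\cdot)$. Sections of $E$ inserted in $\mathrm{Rm},\nabla H,H^{(2)}$ stand for their images under $\pi$. Let $D^0$ be the canonical generalised Levi-Civita connection with metric divergence $\mathrm{div}^{\mathcal G}(v)=\mathrm{tr}\,\nabla(\pi v)$: it preserves $E_\pm$ and, for $v\in\Gamma(E_\pm)$, $\pi D^0_uv=\nabla_{\pi u}\pi v\pm\tfrac16 g^{-1}H(\pi u,\pi v,\cdot)$ if $u\in\Gamma(E_\pm)$ and $\pi D^0_uv=\nabla_{\pi u}\pi v\pm\tfrac12 g^{-1}H(\pi u,\pi v,\cdot)$ if $u\in\Gamma(E_\mp)$. Let $\mathrm{div}=\mathrm{div}^{\mathcal G}-\langle e,\cdot\rangle$, $e=e_++e_-\in\Gamma(E)$,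 $e_\pm\in\Gamma(E_\pm)$, be a divergence operator. Let $\mathfrak{so}(E)_{\mathcal G}^{\langle1\rangle}$ be the bundle of $S\in E^*\otimes\mathrm{End}\,E$ such that each $S_u$ is skew with respect to $\langle\cdot,\cdot\rangle$ and $\mathcal G$ and $\langle S_uv,w\rangle+\langle S_vw,u\rangle+\langle S_wu,v\rangle=0$, and let $(\mathrm{tr}\,S)(v)=\mathrm{tr}(u\mapsto S_uv)$. Let $D=D^0+S$ be the canonical generalised Levi-Civita connection of $(\mathcal G,\mathrm{div})$, where $S$ is the unique section of $\mathfrak{so}(E)_{\mathcal G}^{\langle1\rangle}$ orthogonal to $\ker\mathrm{tr}$ with $\mathrm{div}^{\mathcal G}+\mathrm{tr}\,S=\mathrm{div}$. The generalised Riemann tensor of $D$ is $$\mathcal Rm^D(a,b,v,w)=\tfrac12\Big\{\langle([D_v,D_w]-D_{[v,w]})b,a\rangle+\langle([D_b,D_a]-D_{[b,a]})v,w\rangle+\mathrm{tr}_E\big(\langle Dv,w\rangle\langle Db,a\rangle\big)\Big\},$$ where $\mathrm{tr}_E$ is the trace with respect to $\langle\cdot,\cdot\rangle$. Finally let $\chi_\pm^{e_\pm}(u,v,w)=\langle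 u,v\rangle\langle e_\pm,w\rangle-\langle e_\pm,v\rangle\langle u,w\rangle$ on $E_\pm$, extended by zero to $E$. Then, for both choices of sign and all $a,v,w\in\Gamma(E_\pm)$ and $\bar b\in\Gamma(E_\mp)$, $$\begin{aligned}\pm2\,\mathcal Rm^D(a,\bar b,v,w)={}&\mathrm{Rm}(a,\bar b,v,w)\mp\tfrac12[\nabla_aH](\bar b,v,w)\pm\tfrac16[\nabla_{\bar b}H](a,v,w)\\&-\tfrac1{12}H^{(2)}(\bar b,w,a,v)-\tfrac1{12}H^{(2)}(w,a,\bar b,v)-\tfrac16H^{(2)}(a,\bar b,v,w)\\&\pm\tfrac1{d-1}[D^0_{\bar b}\chi_\pm^{e_\pm}](a,v,w).\end{aligned}$$ -/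

import Mathlib

open Bundle
open scoped Manifold ContDiff

set_option linter.unusedSectionVars false

noncomputable section

namespace GenGeom

section Basic

variable {d : ℕ} {M : Type*} [TopologicalSpace M] [ChartedSpace (EuclideanSpace ℝ (Fin d)) M]

/-- Smoothness of a (global) vector field. -/
def SmoothField [IsManifold (𝓡 d) ∞ M] (X : ∀ x : M, TangentSpace (𝓡 d) x) : Prop :=
  ContMDiff (𝓡 d) ((𝓡 d).prod 𝓘(ℝ, EuclideanSpace ℝ (Fin d))) ∞
    (fun x => TotalSpace.mk' (EuclideanSpace ℝ (Fin d)) x (X x))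

/-- Smoothness of a real function. -/
def SmoothFun (d : ℕ) {M : Type*} [TopologicalSpace M]
    [ChartedSpace (EuclideanSpace ℝ (Fin d)) M] (f : M → ℝ) : Prop :=
  ContMDiff (𝓡 d) 𝓘(ℝ, ℝ) ∞ f

/-- Smoothness of a (global) section of a vector bundle `E` with typical fibre `F`. -/
def SmoothSection (d : ℕ) {M : Type*} [TopologicalSpace M]
    [ChartedSpace (EuclideanSpace ℝ (Fin d)) M]
    (F : Type*) [NormedAddCommGroup F] [NormedSpace ℝ F]
    {E : M → Type*} [TopologicalSpace (TotalSpace F E)]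
    [∀ x, TopologicalSpace (E x)] [FiberBundle F E] (u : ∀ x : M, E x) : Prop :=
  ContMDiff (𝓡 d) ((𝓡 d).prod 𝓘(ℝ, F)) ∞ (fun x => TotalSpace.mk' F x (u x))

/-- The derivative `X f` of a function along a vector field. -/
def dirDeriv (X : ∀ x : M, TangentSpace (𝓡 d) x) (f : M → ℝ) (x : M) : ℝ :=
  mvfderiv (𝓡 d) f x (X x)

/-- Contraction of a bilinear `β` with a nondegenerate symmetric form `B`:
`∑ i, β (b i) (b' i)`, where `b` is a basis and `b'` its `B`-dual basis. -/
def contract {V : Type*} [AddCommGroup V] [Module ℝ V] [FiniteDimensional ℝ V]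
    (B : LinearMap.BilinForm ℝ V) (hB : B.Nondegenerate) (β : V → V → ℝ) : ℝ :=
  ∑ i, β (Module.finBasis ℝ V i) (B.dualBasis hB (Module.finBasis ℝ V) i)

end Basic

/-- An exact Courant algebroid over a `d`-dimensional manifold `M`: a smooth vector bundle `E → M`
with a scalar product, an anchor `π : E → TM` and a (Dorfman) bracket on its sections, such that
`0 → T*M → E → TM → 0` is exact, where `T*M → E` is the dual of `π` followed by the
identification `E* ≅ E` given by the scalar product. Only the values of the bracket on smooth
sections are meaningful. -/
structure ExactCourantAlgebroid (d : ℕ) {M : Type*} [TopologicalSpace M]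
    [ChartedSpace (EuclideanSpace ℝ (Fin d)) M] [IsManifold (𝓡 d) ∞ M]
    (F : Type*) [NormedAddCommGroup F] [NormedSpace ℝ F]
    (E : M → Type*) [TopologicalSpace (TotalSpace F E)]
    [∀ x, AddCommGroup (E x)] [∀ x, Module ℝ (E x)] [∀ x, TopologicalSpace (E x)]
    [FiberBundle F E] where
  pair : ∀ x : M, LinearMap.BilinForm ℝ (E x)
  anchor : ∀ x : M, E x →ₗ[ℝ] TangentSpace (𝓡 d) x
  bracket : (∀ x : M, E x) → (∀ x : M, E x) → (∀ x : M, E x)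
  pair_symm : ∀ x (u v : E x), pair x u v = pair x v u
  pair_nondeg : ∀ x, (pair x).Nondegenerate
  pair_smooth : ∀ u v : (∀ x : M, E x), SmoothSection d F u → SmoothSection d F v →
    SmoothFun d (fun x => pair x (u x) (v x))
  anchor_smooth : ∀ u : (∀ x : M, E x), SmoothSection d F u →
    SmoothField (fun x => anchor x (u x))
  bracket_smooth : ∀ u v : (∀ x : M, E x), SmoothSection d F u → SmoothSection d F v →
    SmoothSection d F (bracket u v)
  bracket_add_left : ∀ u v w : (∀ x : M, E x), SmoothSection d F u → SmoothSection d F v →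
    SmoothSection d F w → bracket (u + v) w = bracket u w + bracket v w
  bracket_add_right : ∀ u v w : (∀ x : M, E x), SmoothSection d F u → SmoothSection d F v →
    SmoothSection d F w → bracket u (v + w) = bracket u v + bracket u w
  bracket_smul_left : ∀ (c : ℝ) (u v : ∀ x : M, E x), SmoothSection d F u →
    SmoothSection d F v → bracket (c • u) v = c • bracket u v
  bracket_leibniz : ∀ (f : M → ℝ) (u v : ∀ x : M, E x), SmoothFun d f → SmoothSection d F u →
    SmoothSection d F v → ∀ x, bracket u (fun y => f y • v y) x =
      f x • bracket u v x + dirDeriv (fun y => anchor y (u y)) f x • v x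
  bracket_jacobi : ∀ u v w : (∀ x : M, E x), SmoothSection d F u → SmoothSection d F v →
    SmoothSection d F w →
    bracket u (bracket v w) = bracket (bracket u v) w + bracket v (bracket u w)
  anchor_bracket : ∀ u v : (∀ x : M, E x), SmoothSection d F u → SmoothSection d F v →
    ∀ x, anchor x (bracket u v x) =
      VectorField.mlieBracket (𝓡 d) (fun y => anchor y (u y)) (fun y => anchor y (v y)) x
  pair_invariant : ∀ u v w : (∀ x : M, E x), SmoothSection d F u → SmoothSection d F v →
    SmoothSection d F w → ∀ x,
    dirDeriv (fun y => anchor y (u y)) (fun y => pair y (v y) (w y)) x =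
      pair x (bracket u v x) (w x) + pair x (v x) (bracket u w x)
  bracket_symm_part : ∀ u v w : (∀ x : M, E x), SmoothSection d F u → SmoothSection d F v →
    SmoothSection d F w → ∀ x,
    pair x (bracket u v x + bracket v u x) (w x) =
      dirDeriv (fun y => anchor y (w y)) (fun y => pair y (u y) (v y)) x
  anchor_surjective : ∀ x, Function.Surjective (anchor x)
  exact_middle : ∀ x (u : E x), anchor x u = 0 ↔
    ∃ ξ : TangentSpace (𝓡 d) x →ₗ[ℝ] ℝ, ∀ v, pair x u v = ξ (anchor x v)

/-- The real number `±1` given by a sign. -/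
def sg (ε : ℤˣ) : ℝ := ((ε : ℤ) : ℝ)

variable {d : ℕ} {M : Type*} [TopologicalSpace M] [ChartedSpace (EuclideanSpace ℝ (Fin d)) M]
  [IsManifold (𝓡 d) ∞ M]
  {F : Type*} [NormedAddCommGroup F] [NormedSpace ℝ F]
  {E : M → Type*} [TopologicalSpace (TotalSpace F E)]
  [∀ x, AddCommGroup (E x)] [∀ x, Module ℝ (E x)] [∀ x, TopologicalSpace (E x)]
  [FiberBundle F E]

/-- A divergence operator: an additive map `div : Γ(E) → C^∞(M)` such that
`div (f v) = f div v + π(v) f`. Only its values on smooth sections are meaningful. -/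
structure DivOperator (C : ExactCourantAlgebroid d F E) where
  op : (∀ x : M, E x) → M → ℝ
  smooth : ∀ v : (∀ x : M, E x), SmoothSection d F v → SmoothFun d (op v)
  add : ∀ u v : (∀ x : M, E x), SmoothSection d F u → SmoothSection d F v →
    op (u + v) = op u + op v
  leibniz : ∀ (f : M → ℝ) (v : ∀ x : M, E x), SmoothFun d f → SmoothSection d F v → ∀ x,
    op (fun y => f y • v y) x = f x * op v x + dirDeriv (fun y => C.anchor y (v y)) f x

/-- A semi-Riemannian generalised metric `𝒢`, encoded by its endomorphism field `endo`, so that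
`𝒢(u, v) = ⟨endo u, v⟩`: `𝒢` is symmetric, `endo` is a smooth involution and the restriction of
`𝒢` to `T*M = ker π` is nondegenerate. -/
structure GenMetric (C : ExactCourantAlgebroid d F E) where
  endo : ∀ x : M, E x →ₗ[ℝ] E x
  symm : ∀ x (u v : E x), C.pair x (endo x u) v = C.pair x (endo x v) u
  invol : ∀ x (u : E x), endo x (endo x u) = u
  smooth : ∀ u : (∀ x : M, E x), SmoothSection d F u →
    SmoothSection d F (fun x => endo x (u x))
  nondeg_ker : ∀ x (u : E x), C.anchor x u = 0 →
    (∀ v, C.anchor x v = 0 → C.pair x (endo x u) v = 0) → u = 0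

/-- The Levi-Civita connection of a semi-Riemannian metric `g`: it is torsion-free, metric, and
maps smooth vector fields to smooth vector fields. The vector `∇_X Y` at `x` is `cov Y x (X x)`. -/
structure IsLeviCivita (g : ∀ x : M, LinearMap.BilinForm ℝ (TangentSpace (𝓡 d) x))
    (cov : CovariantDerivative (𝓡 d) (EuclideanSpace ℝ (Fin d))
      (TangentSpace (𝓡 d) : M → Type _)) : Prop where
  torsion_free : ∀ X Y : (∀ x : M, TangentSpace (𝓡 d) x), SmoothField X → SmoothField Y →
    ∀ x, cov Y x (X x) - cov X x (Y x) = VectorField.mlieBracket (𝓡 d) X Y x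
  metric : ∀ X Y Z : (∀ x : M, TangentSpace (𝓡 d) x), SmoothField X → SmoothField Y →
    SmoothField Z → ∀ x, dirDeriv X (fun y => g y (Y y) (Z y)) x =
      g x (cov Y x (X x)) (Z x) + g x (Y x) (cov Z x (X x))
  smooth : ∀ X Y : (∀ x : M, TangentSpace (𝓡 d) x), SmoothField X → SmoothField Y →
    SmoothField (fun x => cov Y x (X x))

/-- The vector field `π u`, for a section `u` of `E`. -/
def ExactCourantAlgebroid.push (C : ExactCourantAlgebroid d F E) (u : ∀ x : M, E x) (x : M) :
    TangentSpace (𝓡 d) x :=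
  C.anchor x (u x)

/-- The metric divergence `div^𝒢`: `div^𝒢(v)` is the divergence `tr ∇(π v)` of the vector field
`π v` with respect to `g`. -/
def metricDiv (C : ExactCourantAlgebroid d F E)
    (cov : CovariantDerivative (𝓡 d) (EuclideanSpace ℝ (Fin d))
      (TangentSpace (𝓡 d) : M → Type _)) (v : ∀ x : M, E x) (x : M) : ℝ :=
  LinearMap.trace ℝ (TangentSpace (𝓡 d) x)
    (cov (fun y => C.anchor y (v y)) x).toLinearMap

/-- `[∇_X H](Y, Z, W)`. -/
def covH (cov : CovariantDerivative (𝓡 d) (EuclideanSpace ℝ (Fin d))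
      (TangentSpace (𝓡 d) : M → Type _))
    (H : ∀ x : M, TangentSpace (𝓡 d) x →ₗ[ℝ] TangentSpace (𝓡 d) x →ₗ[ℝ]
      TangentSpace (𝓡 d) x →ₗ[ℝ] ℝ) (X Y Z W : ∀ x : M, TangentSpace (𝓡 d) x) (x : M) : ℝ :=
  dirDeriv X (fun y => H y (Y y) (Z y) (W y)) x - H x (cov Y x (X x)) (Z x) (W x)
    - H x (Y x) (cov Z x (X x)) (W x) - H x (Y x) (Z x) (cov W x (X x))

/-- `tr_E β = ∑ β(e_A, e^A)`, the trace of a bilinear form on `E` with respect to `⟨·,·⟩`. -/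
def trE [FiniteDimensional ℝ F] [VectorBundle ℝ F E] (C : ExactCourantAlgebroid d F E)
    (x : M) (β : E x → E x → ℝ) : ℝ :=
  haveI : FiniteDimensional ℝ (E x) := VectorBundle.finiteDimensional ℝ F E x
  contract (C.pair x) (C.pair_nondeg x) β

namespace GenMetric

variable {C : ExactCourantAlgebroid d F E} (G : GenMetric C)

/-- The fibre at `x` of `E_±`, the `±1`-eigenbundle of the generalised metric. -/
def eig (ε : ℤˣ) (x : M) : Submodule ℝ (E x) :=
  LinearMap.ker (G.endo x - sg ε • LinearMap.id)

lemma mem_eig {ε : ℤˣ} {x : M} {u : E x} : u ∈ G.eig ε x ↔ G.endo x u = sg ε • u := by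
  simp [eig, sub_eq_zero]

/-- The projection `E → E_±` along `E_∓`. -/
def proj (ε : ℤˣ) (x : M) : E x →ₗ[ℝ] E x :=
  (1 / 2 : ℝ) • (LinearMap.id + sg ε • G.endo x)

lemma proj_mem (ε : ℤˣ) (x : M) (u : E x) : G.proj ε x u ∈ G.eig ε x := by
  rw [mem_eig]
  simp only [proj, LinearMap.smul_apply, LinearMap.add_apply, LinearMap.id_apply, map_smul,
    map_add, G.invol]
  rcases Int.units_eq_one_or ε with rfl | rfl <;> simp only [sg] <;> push_cast <;> module

lemma proj_add (x : M) (u : E x) : G.proj 1 x u + G.proj (-1) x u = u := by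
  simp only [proj, LinearMap.smul_apply, LinearMap.add_apply, LinearMap.id_apply, sg]
  push_cast
  module

lemma pair_eig {x : M} {ε : ℤˣ} {u v : E x} (hu : u ∈ G.eig ε x) (hv : v ∈ G.eig (-ε) x) :
    C.pair x u v = 0 := by
  rw [mem_eig] at hu hv
  have h := G.symm x u v
  rw [hu, hv, C.pair_symm x (sg (-ε) • v) u] at h
  simp only [map_smul, LinearMap.smul_apply, smul_eq_mul] at h
  rcases Int.units_eq_one_or ε with rfl | rfl <;> simp [sg] at h <;> linarith

lemma eq_zero_of_anchor {x : M} {ε : ℤˣ} {u : E x} (hu : u ∈ G.eig ε x)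
    (h0 : C.anchor x u = 0) : u = 0 := by
  refine G.nondeg_ker x u h0 fun v hv => ?_
  rw [G.mem_eig.1 hu]
  obtain ⟨ξ, hξ⟩ := (C.exact_middle x u).1 h0
  simp [hξ, hv]

lemma eig_ortho {x : M} {ε : ℤˣ} {u : E x} (h : ∀ v ∈ G.eig ε x, C.pair x u v = 0) :
    u ∈ G.eig (-ε) x := by
  have h1 : G.proj ε x u = 0 := by
    refine (C.pair_nondeg x).1 _ fun v => ?_
    have hs : G.proj ε x u = u - G.proj (-ε) x u := by
      rw [eq_sub_iff_add_eq]
      rcases Int.units_eq_one_or ε with rfl | rfl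
      · exact G.proj_add x u
      · rw [neg_neg, add_comm]; exact G.proj_add x u
    have hv : v = G.proj ε x v + G.proj (-ε) x v := by
      rcases Int.units_eq_one_or ε with rfl | rfl
      · exact (G.proj_add x v).symm
      · rw [neg_neg, add_comm]; exact (G.proj_add x v).symm
    have e2 : C.pair x (G.proj ε x u) (G.proj (-ε) x v) = 0 :=
      G.pair_eig (G.proj_mem ε x u) (G.proj_mem (-ε) x v)
    have e3 : C.pair x (G.proj (-ε) x u) (G.proj ε x v) = 0 := by
      rw [C.pair_symm]
      exact G.pair_eig (G.proj_mem ε x v) (G.proj_mem (-ε) x u)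
    rw [hv, map_add, e2, add_zero, hs, map_sub, LinearMap.sub_apply, e3,
      h _ (G.proj_mem ε x v), sub_zero]
  have h2 : G.proj (-ε) x u = u := by
    rcases Int.units_eq_one_or ε with rfl | rfl
    · have := G.proj_add x u
      rwa [h1, zero_add] at this
    · have := G.proj_add x u
      rw [h1, add_zero] at this
      rwa [neg_neg]
  rw [← h2]
  exact G.proj_mem (-ε) x u

variable [FiniteDimensional ℝ F] [VectorBundle ℝ F E]

lemma anchor_bijective (ε : ℤˣ) (x : M) :
    Function.Bijective ((C.anchor x).domRestrict (G.eig ε x)) := by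
  have : FiniteDimensional ℝ (E x) := VectorBundle.finiteDimensional ℝ F E x
  constructor
  · rw [← LinearMap.ker_eq_bot, LinearMap.ker_eq_bot']
    rintro ⟨u, hu⟩ h
    exact Subtype.ext (G.eq_zero_of_anchor hu h)
  · rw [← LinearMap.range_eq_top]
    by_contra hne
    obtain ⟨ξ, hξ0, hξ⟩ := Submodule.exists_le_ker_of_lt_top _ (lt_top_iff_ne_top.2 hne)
    set u : E x := ((C.pair x).toDual (C.pair_nondeg x)).symm (ξ ∘ₗ C.anchor x) with hu
    have key : ∀ v, C.pair x u v = ξ (C.anchor x v) := fun v => by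
      rw [hu, LinearMap.BilinForm.apply_toDual_symm_apply]; rfl
    have h0 : C.anchor x u = 0 := (C.exact_middle x u).2 ⟨ξ, key⟩
    have hm : u ∈ G.eig (-ε) x := G.eig_ortho fun v hv => by
      rw [key]
      exact hξ ⟨⟨v, hv⟩, rfl⟩
    have hz := G.eq_zero_of_anchor hm h0
    refine hξ0 (LinearMap.ext fun t => ?_)
    obtain ⟨v, rfl⟩ := C.anchor_surjective x t
    rw [← key, hz]; simp

/-- The inverse of the isomorphism `π : E_± → TM`, as a map `TM → E`. -/
def lift (ε : ℤˣ) (x : M) : TangentSpace (𝓡 d) x →ₗ[ℝ] E x :=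
  (G.eig ε x).subtype ∘ₗ
    (LinearEquiv.ofBijective _ (G.anchor_bijective ε x)).symm.toLinearMap

lemma lift_mem (ε : ℤˣ) (x : M) (X : TangentSpace (𝓡 d) x) : G.lift ε x X ∈ G.eig ε x := by
  simp [lift]

lemma anchor_lift (ε : ℤˣ) (x : M) (X : TangentSpace (𝓡 d) x) :
    C.anchor x (G.lift ε x X) = X :=
  (LinearEquiv.ofBijective _ (G.anchor_bijective ε x)).apply_symm_apply X

lemma lift_anchor {ε : ℤˣ} {x : M} {u : E x} (hu : u ∈ G.eig ε x) :
    G.lift ε x (C.anchor x u) = u :=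
  congrArg Subtype.val
    ((LinearEquiv.ofBijective _ (G.anchor_bijective ε x)).symm_apply_apply ⟨u, hu⟩)

/-- The semi-Riemannian metric `g` on `M` with `g(π a, π b) = ⟨a, b⟩` for `a, b ∈ E_+`. -/
def metric (x : M) : LinearMap.BilinForm ℝ (TangentSpace (𝓡 d) x) :=
  (C.pair x).compl₁₂ (G.lift 1 x) (G.lift 1 x)

lemma metric_nondeg (x : M) : (G.metric x).Nondegenerate := by
  have key : ∀ X, (∀ Y, G.metric x X Y = 0) → X = 0 := fun X h => by
    have h1 : G.lift 1 x X ∈ G.eig (-1) x := G.eig_ortho fun v hv => by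
      have := h (C.anchor x v)
      rwa [metric, LinearMap.compl₁₂_apply, G.lift_anchor hv] at this
    have h2 : G.lift 1 x X = 0 := (C.pair_nondeg x).1 _ fun v => by
      rw [← G.proj_add x v, map_add, G.pair_eig (G.lift_mem 1 x X) (G.proj_mem (-1) x v),
        C.pair_symm, G.pair_eig (G.proj_mem 1 x v) h1, add_zero]
    rw [← G.anchor_lift 1 x X, h2, map_zero]
  refine ⟨key, fun X h => key X fun Y => ?_⟩
  have := h Y
  rwa [metric, LinearMap.compl₁₂_apply, C.pair_symm] at this

/-- The isotropic splitting `s : TM → E` of `π` determined by the generalised metric,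
`s X = (X_+ + X_-) / 2` with `X_± ∈ E_±` the elements over `X`. -/
def split (x : M) : TangentSpace (𝓡 d) x →ₗ[ℝ] E x :=
  (1 / 2 : ℝ) • (G.lift 1 x + G.lift (-1) x)

/-- `H` is the three-form of `E` in the splitting `s`: `H(X, Y, Z) = 2 ⟨[s X, s Y], s Z⟩`. Under the
identification `E = TM ⊕ T*M`, `⟨X + ξ, Y + η⟩ = (ξ(Y) + η(X)) / 2`, given by `s`, the bracket is
`[X + ξ, Y + η] = [X, Y] + L_X η - ι_Y dξ + H(X, Y, ·)`. -/
def IsThreeForm (H : ∀ x : M, TangentSpace (𝓡 d) x →ₗ[ℝ] TangentSpace (𝓡 d) x →ₗ[ℝ]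
    TangentSpace (𝓡 d) x →ₗ[ℝ] ℝ) : Prop :=
  ∀ X Y Z : (∀ x : M, TangentSpace (𝓡 d) x), SmoothField X → SmoothField Y → SmoothField Z →
    ∀ x, H x (X x) (Y x) (Z x) =
      2 * C.pair x (C.bracket (fun y => G.split y (X y)) (fun y => G.split y (Y y)) x)
        (G.split x (Z x))

variable (cov : CovariantDerivative (𝓡 d) (EuclideanSpace ℝ (Fin d))
    (TangentSpace (𝓡 d) : M → Type _))
  (H : ∀ x : M, TangentSpace (𝓡 d) x →ₗ[ℝ] TangentSpace (𝓡 d) x →ₗ[ℝ]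
    TangentSpace (𝓡 d) x →ₗ[ℝ] ℝ)

/-- `(X, Y) ↦ g⁻¹ H(X, Y, ·)`. -/
def sharpH (x : M) : TangentSpace (𝓡 d) x →ₗ[ℝ] TangentSpace (𝓡 d) x →ₗ[ℝ]
    TangentSpace (𝓡 d) x :=
  haveI : FiniteDimensional ℝ (TangentSpace (𝓡 d) x) :=
    inferInstanceAs (FiniteDimensional ℝ (EuclideanSpace ℝ (Fin d)))
  (H x).compr₂ ((G.metric x).toDual (G.metric_nondeg x)).symm.toLinearMap

/-- `H^{(2)}(X, Y, Z, W)`, the `g`-contraction of `H(X, Y, ·)` with `H(Z, W, ·)`. -/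
def H2 (x : M) (X Y Z W : TangentSpace (𝓡 d) x) : ℝ :=
  G.metric x (G.sharpH H x X Y) (G.sharpH H x Z W)

/-- `Rm(X, Y, Z, W) = g(R(X, Y) W, Z)`, `R(X, Y) = ∇_X ∇_Y - ∇_Y ∇_X - ∇_{[X, Y]}`
(so that the Ricci tensor is the `g`-trace of `Rm(·, Y, ·, W)`). -/
def riem (X Y Z W : ∀ x : M, TangentSpace (𝓡 d) x) (x : M) : ℝ :=
  G.metric x (cov (fun y => cov W y (Y y)) x (X x) - cov (fun y => cov W y (X y)) x (Y x)
    - cov W x (VectorField.mlieBracket (𝓡 d) X Y x)) (Z x)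

/-- The `E_±`-part of `D⁰`: for `v ∈ Γ(E_±)`,
`π(D⁰_u v) = ∇_{π u} π v ± (1/6) g⁻¹ H(π u, π v, ·)` if `u ∈ E_±` and
`π(D⁰_u v) = ∇_{π u} π v ± (1/2) g⁻¹ H(π u, π v, ·)` if `u ∈ E_∓`. -/
def connZeroPart (ε : ℤˣ) (v : ∀ x : M, E x) (x : M) : E x →ₗ[ℝ] E x :=
  let Y : ∀ y : M, TangentSpace (𝓡 d) y := fun y => C.anchor y (G.proj ε y (v y))
  G.lift ε x ∘ₗ
    ((cov Y x).toLinearMap ∘ₗ C.anchor x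
      + (sg ε / 6) • ((G.sharpH H x).flip (Y x) ∘ₗ C.anchor x ∘ₗ G.proj ε x)
      + (sg ε / 2) • ((G.sharpH H x).flip (Y x) ∘ₗ C.anchor x ∘ₗ G.proj (-ε) x))

/-- The canonical generalised Levi-Civita connection `D⁰` with metric divergence; `D⁰_u v` at `x`
is `connZero v x (u x)`. -/
def connZero (v : ∀ x : M, E x) (x : M) : E x →ₗ[ℝ] E x :=
  G.connZeroPart cov H 1 v x + G.connZeroPart cov H (-1) v x

/-- The fibre at `x` of `𝔰𝔬(E)^{⟨1⟩}_𝒢`: sections `S` of `E* ⊗ End E` with `S_u` skew for `⟨·,·⟩`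
and for `𝒢`, and with vanishing total skew-symmetrisation of `⟨S_u v, w⟩`. -/
def IsProlongation (x : M) (S : E x →ₗ[ℝ] E x →ₗ[ℝ] E x) : Prop :=
  (∀ u v w, C.pair x (S u v) w = -C.pair x v (S u w)) ∧
  (∀ u v w, C.pair x (G.endo x (S u v)) w = -C.pair x (G.endo x v) (S u w)) ∧
  (∀ u v w, C.pair x (S u v) w + C.pair x (S v w) u + C.pair x (S w u) v = 0)

/-- `S` is, at `x`, the section of `𝔰𝔬(E)^{⟨1⟩}_𝒢` that is orthogonal to the kernel of
`tr : 𝔰𝔬(E)^{⟨1⟩}_𝒢 → E*`, `(tr S)(v) = tr (u ↦ S_u v)`, and has `div^𝒢 + tr S = div`.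
The scalar product of tensors is the one induced by `⟨·,·⟩`. -/
def IsDivTensor (dv : DivOperator C) (x : M) (S : E x →ₗ[ℝ] E x →ₗ[ℝ] E x) : Prop :=
  G.IsProlongation x S ∧
  (∀ v : (∀ x : M, E x), SmoothSection d F v →
    metricDiv C cov v x + LinearMap.trace ℝ (E x) (S.flip (v x)) = dv.op v x) ∧
  (∀ T : E x →ₗ[ℝ] E x →ₗ[ℝ] E x, G.IsProlongation x T →
    (∀ v, LinearMap.trace ℝ (E x) (T.flip v) = 0) →
    trE C x (fun u u' => trE C x (fun v v' => C.pair x (S u v) (T u' v'))) = 0)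

/-- The tensor `S` determined by `𝒢` and `div`. -/
def divTensor (dv : DivOperator C) (x : M) : E x →ₗ[ℝ] E x →ₗ[ℝ] E x :=
  Classical.epsilon (G.IsDivTensor cov dv x)

/-- The canonical generalised Levi-Civita connection `D = D⁰ + S` of `(𝒢, div)`; `D_u v` at `x` is
`conn v x (u x)`. -/
def conn (dv : DivOperator C) (v : ∀ x : M, E x) (x : M) : E x →ₗ[ℝ] E x :=
  G.connZero cov H v x + (G.divTensor cov dv x).flip (v x)

/-- The tensor `χ_±^f`, `f ∈ E_±`:
`χ_±^f(u, v, w) = ⟨u, v⟩⟨f, w⟩ - ⟨f, v⟩⟨u, w⟩` on `E_±`, extended by zero. -/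
def chi (ε : ℤˣ) (f : ∀ x : M, E x) (x : M) (u v w : E x) : ℝ :=
  C.pair x (G.proj ε x u) (G.proj ε x v) * C.pair x (f x) (G.proj ε x w)
    - C.pair x (f x) (G.proj ε x v) * C.pair x (G.proj ε x u) (G.proj ε x w)

end GenMetric

/-- `[D_u T](a, v, w)` for a trilinear tensor field `T` on `E`. -/
def covTensor (C : ExactCourantAlgebroid d F E)
    (D : (∀ x : M, E x) → ∀ x : M, E x →ₗ[ℝ] E x)
    (T : ∀ x : M, E x → E x → E x → ℝ) (u a v w : ∀ x : M, E x) (x : M) : ℝ :=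
  dirDeriv (fun y => C.anchor y (u y)) (fun y => T y (a y) (v y) (w y)) x
    - T x (D a x (u x)) (v x) (w x) - T x (a x) (D v x (u x)) (w x)
    - T x (a x) (v x) (D w x (u x))

/-- `R(u, v) w = D_u D_v w - D_v D_u w - D_{[u, v]} w` (not tensorial). -/
def bareCurv (C : ExactCourantAlgebroid d F E)
    (D : (∀ x : M, E x) → ∀ x : M, E x →ₗ[ℝ] E x)
    (u v w : ∀ x : M, E x) (x : M) : E x :=
  D (fun y => D w y (v y)) x (u x) - D (fun y => D w y (u y)) x (v x)
    - D w x (C.bracket u v x)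

/-- The generalised Riemann tensor of a generalised connection:
`Rm(a, b, v, w) = (⟨R(v, w) b, a⟩ + ⟨R(b, a) v, w⟩ + tr_E (⟨D v, w⟩ ⟨D b, a⟩)) / 2`. -/
def genRiem [FiniteDimensional ℝ F] [VectorBundle ℝ F E] (C : ExactCourantAlgebroid d F E)
    (D : (∀ x : M, E x) → ∀ x : M, E x →ₗ[ℝ] E x)
    (a b v w : ∀ x : M, E x) (x : M) : ℝ :=
  (1 / 2) * (C.pair x (bareCurv C D v w b x) (a x) + C.pair x (bareCurv C D b a v x) (w x)
    + trE C x (fun u u' => C.pair x (D v x u) (w x) * C.pair x (D b x u') (a x)))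

end GenGeom
end

noncomputable section

namespace GenGeom

section Contraction

variable {V : Type*} [AddCommGroup V] [Module ℝ V] [FiniteDimensional ℝ V]

lemma trace_smulRight (φ : V →ₗ[ℝ] ℝ) (f : V) :
    LinearMap.trace ℝ V (φ.smulRight f) = φ f := by
  have h : φ.smulRight f = dualTensorHom ℝ V V (φ ⊗ₜ[ℝ] f) := by
    ext v; simp
  rw [h, LinearMap.trace_eq_contract_apply, contractLeft_apply]

variable (B : LinearMap.BilinForm ℝ V) (hB : B.Nondegenerate)

lemma contract_eq_trace (hs : ∀ u v, B u v = B v u) (L : V →ₗ[ℝ] V) :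
    contract B hB (fun u u' => B (L u) u') = LinearMap.trace ℝ V L := by
  classical
  have key : ∀ v i, (Module.finBasis ℝ V).repr v i
      = B v (B.dualBasis hB (Module.finBasis ℝ V) i) := by
    intro v i
    conv_rhs => rw [← (Module.finBasis ℝ V).sum_repr v]
    simp only [map_sum, LinearMap.sum_apply, map_smul, LinearMap.smul_apply, smul_eq_mul]
    rw [Finset.sum_eq_single i]
    · rw [LinearMap.BilinForm.apply_dualBasis_right hB ⟨hs⟩]; simp
    · intro j _ hj
      rw [LinearMap.BilinForm.apply_dualBasis_right hB ⟨hs⟩]; simp [hj]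
    · simp
  rw [LinearMap.trace_eq_matrix_trace ℝ (Module.finBasis ℝ V), contract, Matrix.trace]
  refine Finset.sum_congr rfl fun i _ => ?_
  rw [Matrix.diag_apply, LinearMap.toMatrix_apply, key]

lemma contract_eq_trace_right (hs : ∀ u v, B u v = B v u) (L : V →ₗ[ℝ] V) :
    contract B hB (fun u u' => B u (L u')) = LinearMap.trace ℝ V L := by
  classical
  rw [LinearMap.trace_eq_matrix_trace ℝ (B.dualBasis hB (Module.finBasis ℝ V)), contract,
    Matrix.trace]
  refine Finset.sum_congr rfl fun i _ => ?_
  rw [Matrix.diag_apply, LinearMap.toMatrix_apply, LinearMap.BilinForm.dualBasis_repr_apply, hs]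

lemma contract_mul (hs : ∀ u v, B u v = B v u) (p q : V) :
    contract B hB (fun u u' => B p u * B q u') = B p q := by
  have h := contract_eq_trace B hB hs ((B p).smulRight q)
  rw [trace_smulRight] at h
  rw [← h]
  simp

lemma contract_add (β β' : V → V → ℝ) :
    contract B hB (fun u u' => β u u' + β' u u') = contract B hB β + contract B hB β' := by
  simp [contract, Finset.sum_add_distrib]

lemma contract_sub (β β' : V → V → ℝ) :
    contract B hB (fun u u' => β u u' - β' u u') = contract B hB β - contract B hB β' := by
  simp [contract, Finset.sum_sub_distrib]

lemma contract_const_mul (c : ℝ) (β : V → V → ℝ) :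
    contract B hB (fun u u' => c * β u u') = c * contract B hB β := by
  simp [contract, Finset.mul_sum]

end Contraction

lemma sg_mul_self (ε : ℤˣ) : sg ε * sg ε = 1 := by
  rcases Int.units_eq_one_or ε with rfl | rfl <;> simp [sg]

lemma sg_neg (ε : ℤˣ) : sg (-ε) = -sg ε := by simp [sg]

variable {d : ℕ} {M : Type*} [TopologicalSpace M] [ChartedSpace (EuclideanSpace ℝ (Fin d)) M]
  [IsManifold (𝓡 d) ∞ M]
  {F : Type*} [NormedAddCommGroup F] [NormedSpace ℝ F]
  {E : M → Type*} [TopologicalSpace (TotalSpace F E)]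
  [∀ x, AddCommGroup (E x)] [∀ x, Module ℝ (E x)] [∀ x, TopologicalSpace (E x)]
  [FiberBundle F E]

namespace GenMetric

variable {C : ExactCourantAlgebroid d F E} (G : GenMetric C)

lemma proj_add_neg (ε : ℤˣ) (x : M) (u : E x) : G.proj ε x u + G.proj (-ε) x u = u := by
  rcases Int.units_eq_one_or ε with rfl | rfl
  · exact G.proj_add x u
  · rw [neg_neg, add_comm]; exact G.proj_add x u

lemma proj_of_mem {ε : ℤˣ} {x : M} {u : E x} (hu : u ∈ G.eig ε x) : G.proj ε x u = u := by
  rw [mem_eig] at hu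
  simp only [proj, LinearMap.smul_apply, LinearMap.add_apply, LinearMap.id_apply, hu, smul_smul,
    sg_mul_self]
  module

lemma proj_of_mem_neg {ε : ℤˣ} {x : M} {u : E x} (hu : u ∈ G.eig (-ε) x) :
    G.proj ε x u = 0 := by
  have h := G.proj_add_neg ε x u
  rwa [G.proj_of_mem hu, add_eq_right] at h

lemma proj_neg_of_mem {ε : ℤˣ} {x : M} {u : E x} (hu : u ∈ G.eig ε x) :
    G.proj (-ε) x u = 0 :=
  G.proj_of_mem_neg (by rwa [neg_neg])

lemma pair_proj (ε : ℤˣ) (x : M) (u v : E x) :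
    C.pair x (G.proj ε x u) v = C.pair x u (G.proj ε x v) := by
  simp only [proj, LinearMap.smul_apply, LinearMap.add_apply, LinearMap.id_apply, map_smul,
    map_add, G.symm x u v, C.pair_symm x (G.endo x v) u]

lemma endo_proj (ε : ℤˣ) (x : M) (u : E x) :
    G.endo x (G.proj ε x u) = sg ε • G.proj ε x u :=
  G.mem_eig.1 (G.proj_mem ε x u)

lemma pair_endo (x : M) (u v : E x) :
    C.pair x (G.endo x u) v = C.pair x u (G.endo x v) := by
  rw [G.symm, C.pair_symm]

lemma eq_of_pair_eig {ε : ℤˣ} {x : M} {u v : E x} (hu : u ∈ G.eig ε x) (hv : v ∈ G.eig ε x)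
    (h : ∀ w ∈ G.eig ε x, C.pair x u w = C.pair x v w) : u = v := by
  rw [← sub_eq_zero]
  refine (C.pair_nondeg x).1 _ fun w => ?_
  rw [← G.proj_add_neg ε x w, map_add, G.pair_eig (sub_mem hu hv) (G.proj_mem (-ε) x w), add_zero,
    map_sub, LinearMap.sub_apply, h _ (G.proj_mem ε x w), sub_self]

namespace IsProlongation

variable {G} {x : M} {S : E x →ₗ[ℝ] E x →ₗ[ℝ] E x}

lemma endo_apply (hS : G.IsProlongation x S) (u v : E x) :
    G.endo x (S u v) = S u (G.endo x v) := by
  rw [← sub_eq_zero]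
  refine (C.pair_nondeg x).1 _ fun w => ?_
  rw [map_sub, LinearMap.sub_apply, hS.2.1, hS.1]
  ring

lemma proj_apply (hS : G.IsProlongation x S) (ε : ℤˣ) (u v : E x) :
    G.proj ε x (S u v) = S u (G.proj ε x v) := by
  simp [proj, hS.endo_apply]

lemma mem (hS : G.IsProlongation x S) {ε : ℤˣ} (u : E x) {v : E x} (hv : v ∈ G.eig ε x) :
    S u v ∈ G.eig ε x := by
  rw [mem_eig] at hv ⊢
  rw [hS.endo_apply, hv, map_smul]

lemma apply_eq_zero (hS : G.IsProlongation x S) {ε : ℤˣ} {u v : E x} (hu : u ∈ G.eig (-ε) x)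
    (hv : v ∈ G.eig ε x) : S u v = 0 := by
  refine G.eq_of_pair_eig (hS.mem u hv) (zero_mem _) fun w hw => ?_
  have h := hS.2.2 u v w
  rw [G.pair_eig (hS.mem v hw) hu, C.pair_symm x (S w u), G.pair_eig hv (hS.mem w hu)] at h
  simpa using h

end IsProlongation

/-- The tensor `u, v ↦ ⟨P_± u, v⟩ f - ⟨f, v⟩ P_± u`, i.e. `χ_±^f` for `f ∈ E_±` with the last
argument raised. -/
def chiMap (ε : ℤˣ) (x : M) (f : E x) : E x →ₗ[ℝ] E x →ₗ[ℝ] E x :=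
  LinearMap.mk₂ ℝ (fun u v => C.pair x (G.proj ε x u) v • f - C.pair x f v • G.proj ε x u)
    (fun u u' v => by simp only [map_add, LinearMap.add_apply]; module)
    (fun c u v => by simp only [map_smul, LinearMap.smul_apply, smul_eq_mul]; module)
    (fun u v v' => by simp only [map_add]; module)
    (fun c u v => by simp only [map_smul, smul_eq_mul]; module)

@[simp] lemma chiMap_apply (ε : ℤˣ) (x : M) (f u v : E x) :
    G.chiMap ε x f u v = C.pair x (G.proj ε x u) v • f - C.pair x f v • G.proj ε x u := rfl

lemma isProlongation_chiMap {ε : ℤˣ} {x : M} {f : E x} (hf : f ∈ G.eig ε x) :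
    G.IsProlongation x (G.chiMap ε x f) := by
  refine ⟨fun u v w => ?_, fun u v w => ?_, fun u v w => ?_⟩
  · simp only [chiMap_apply, map_sub, map_smul, LinearMap.sub_apply, LinearMap.smul_apply,
      smul_eq_mul, C.pair_symm x v]
    ring
  · rw [G.pair_endo, G.pair_endo]
    simp only [chiMap_apply, map_sub, map_smul, LinearMap.sub_apply, LinearMap.smul_apply,
      smul_eq_mul, C.pair_symm x v, ← G.pair_endo, G.mem_eig.1 hf, G.endo_proj]
    ring
  · have h : ∀ u v : E x, C.pair x (G.proj ε x u) v = C.pair x (G.proj ε x v) u := fun u v => by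
      rw [G.pair_proj, C.pair_symm]
    simp only [chiMap_apply, map_sub, map_smul, LinearMap.sub_apply, LinearMap.smul_apply,
      smul_eq_mul]
    rw [h v u, h w u, h w v]
    ring

lemma IsProlongation.add {x : M} {S T : E x →ₗ[ℝ] E x →ₗ[ℝ] E x} (hS : G.IsProlongation x S)
    (hT : G.IsProlongation x T) : G.IsProlongation x (S + T) := by
  refine ⟨fun u v w => ?_, fun u v w => ?_, fun u v w => ?_⟩
  · simp only [LinearMap.add_apply, map_add, hS.1, hT.1]; ring
  · simp only [LinearMap.add_apply, map_add, hS.2.1, hT.2.1]; ring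
  · simp only [LinearMap.add_apply, map_add]; linarith [hS.2.2 u v w, hT.2.2 u v w]

lemma IsProlongation.smul {x : M} {S : E x →ₗ[ℝ] E x →ₗ[ℝ] E x} (hS : G.IsProlongation x S)
    (c : ℝ) : G.IsProlongation x (c • S) := by
  refine ⟨fun u v w => ?_, fun u v w => ?_, fun u v w => ?_⟩
  · simp only [LinearMap.smul_apply, map_smul, hS.1, smul_eq_mul]; ring
  · simp only [LinearMap.smul_apply, map_smul, hS.2.1, smul_eq_mul]; ring
  · simp only [LinearMap.smul_apply, map_smul, smul_eq_mul]
    linear_combination c * hS.2.2 u v w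

/-- The tensor `u, v ↦ ⟨α, u⟩ (⟨β, v⟩ γ - ⟨γ, v⟩ β)`. -/
def wedgeMap (C : ExactCourantAlgebroid d F E) (x : M) (α β γ : E x) :
    E x →ₗ[ℝ] E x →ₗ[ℝ] E x :=
  LinearMap.mk₂ ℝ (fun u v => C.pair x α u • (C.pair x β v • γ - C.pair x γ v • β))
    (fun u u' v => by simp only [map_add]; module)
    (fun c u v => by simp only [map_smul, smul_eq_mul]; module)
    (fun u v v' => by simp only [map_add]; module)
    (fun c u v => by simp only [map_smul, smul_eq_mul]; module)

@[simp] lemma wedgeMap_apply (x : M) (α β γ u v : E x) :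
    wedgeMap C x α β γ u v = C.pair x α u • (C.pair x β v • γ - C.pair x γ v • β) := rfl

/-- `wedgeMap` with its total skew-symmetrisation removed. -/
def hookMap (C : ExactCourantAlgebroid d F E) (x : M) (α β γ : E x) :
    E x →ₗ[ℝ] E x →ₗ[ℝ] E x :=
  wedgeMap C x α β γ + (-(1 / 3 : ℝ)) •
    (wedgeMap C x α β γ + wedgeMap C x β γ α + wedgeMap C x γ α β)

lemma isProlongation_hookMap {ε : ℤˣ} {x : M} {α β γ : E x} (hα : α ∈ G.eig ε x)
    (hβ : β ∈ G.eig ε x) (hγ : γ ∈ G.eig ε x) : G.IsProlongation x (hookMap C x α β γ) := by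
  refine ⟨fun u v w => ?_, fun u v w => ?_, fun u v w => ?_⟩
  · simp only [hookMap, wedgeMap_apply, map_sub, map_smul, LinearMap.sub_apply, map_add,
      LinearMap.smul_apply, LinearMap.add_apply, smul_eq_mul, C.pair_symm x v]
    ring
  · rw [G.pair_endo, G.pair_endo]
    simp only [hookMap, wedgeMap_apply, map_sub, map_smul, LinearMap.sub_apply, map_add,
      LinearMap.smul_apply, LinearMap.add_apply, smul_eq_mul, C.pair_symm x v, ← G.pair_endo,
      G.mem_eig.1 hα, G.mem_eig.1 hβ, G.mem_eig.1 hγ]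
    ring
  · simp only [hookMap, wedgeMap_apply, map_sub, map_smul, LinearMap.sub_apply, map_add,
      LinearMap.smul_apply, LinearMap.add_apply, smul_eq_mul]
    ring

variable [FiniteDimensional ℝ F] [VectorBundle ℝ F E]

lemma trace_proj (ε : ℤˣ) (x : M) : LinearMap.trace ℝ (E x) (G.proj ε x) = d := by
  have : FiniteDimensional ℝ (E x) := VectorBundle.finiteDimensional ℝ F E x
  have : FiniteDimensional ℝ (TangentSpace (𝓡 d) x) :=
    inferInstanceAs (FiniteDimensional ℝ (EuclideanSpace ℝ (Fin d)))
  have h : G.proj ε x = G.lift ε x ∘ₗ (C.anchor x ∘ₗ G.proj ε x) :=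
    LinearMap.ext fun u => (G.lift_anchor (G.proj_mem ε x u)).symm
  have h' : (C.anchor x ∘ₗ G.proj ε x) ∘ₗ G.lift ε x = LinearMap.id :=
    LinearMap.ext fun u => by
      simp [G.proj_of_mem (G.lift_mem ε x u), G.anchor_lift]
  rw [h, LinearMap.trace_comp_comm', h', LinearMap.trace_id]
  congr 1
  exact finrank_euclideanSpace_fin (𝕜 := ℝ) (n := d)

lemma trace_chiMap (ε : ℤˣ) (x : M) {f : E x} (hf : f ∈ G.eig ε x) (v : E x) :
    LinearMap.trace ℝ (E x) ((G.chiMap ε x f).flip v) = (1 - d) * C.pair x f v := by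
  have : FiniteDimensional ℝ (E x) := VectorBundle.finiteDimensional ℝ F E x
  have h : (G.chiMap ε x f).flip v
      = (C.pair x v ∘ₗ G.proj ε x).smulRight f - C.pair x f v • G.proj ε x :=
    LinearMap.ext fun u => by simp [C.pair_symm x v]
  rw [h, map_sub, trace_smulRight, map_smul, G.trace_proj, LinearMap.comp_apply,
    G.proj_of_mem hf, smul_eq_mul, C.pair_symm x v]
  ring

lemma trace_wedgeMap (x : M) (α β γ v : E x) :
    LinearMap.trace ℝ (E x) ((wedgeMap C x α β γ).flip v)
      = C.pair x α γ * C.pair x β v - C.pair x α β * C.pair x γ v := by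
  have : FiniteDimensional ℝ (E x) := VectorBundle.finiteDimensional ℝ F E x
  have h : (wedgeMap C x α β γ).flip v
      = (C.pair x α).smulRight (C.pair x β v • γ - C.pair x γ v • β) :=
    LinearMap.ext fun u => rfl
  rw [h, trace_smulRight]
  simp
  ring

lemma trace_hookMap (x : M) (α β γ v : E x) :
    LinearMap.trace ℝ (E x) ((hookMap C x α β γ).flip v)
      = C.pair x α γ * C.pair x β v - C.pair x α β * C.pair x γ v := by
  have h : (hookMap C x α β γ).flip v = (wedgeMap C x α β γ).flip v + (-(1 / 3 : ℝ)) •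
    ((wedgeMap C x α β γ).flip v + (wedgeMap C x β γ α).flip v + (wedgeMap C x γ α β).flip v) :=
    rfl
  rw [h]
  simp only [map_add, map_smul, trace_wedgeMap, smul_eq_mul, C.pair_symm x β α,
    C.pair_symm x γ α, C.pair_symm x γ β]
  ring

/-- The scalar product of the tensors `S` and `T`. -/
def dot (C : ExactCourantAlgebroid d F E) (x : M) (S T : E x →ₗ[ℝ] E x →ₗ[ℝ] E x) : ℝ :=
  trE C x (fun u u' => trE C x (fun v v' => C.pair x (S u v) (T u' v')))

lemma trE_eq_trace (x : M) (L : E x →ₗ[ℝ] E x) :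
    trE C x (fun u u' => C.pair x (L u) u') = LinearMap.trace ℝ (E x) L :=
  haveI : FiniteDimensional ℝ (E x) := VectorBundle.finiteDimensional ℝ F E x
  contract_eq_trace (C.pair x) (C.pair_nondeg x) (C.pair_symm x) L

lemma trE_eq_trace_right (x : M) (L : E x →ₗ[ℝ] E x) :
    trE C x (fun u u' => C.pair x u (L u')) = LinearMap.trace ℝ (E x) L :=
  haveI : FiniteDimensional ℝ (E x) := VectorBundle.finiteDimensional ℝ F E x
  contract_eq_trace_right (C.pair x) (C.pair_nondeg x) (C.pair_symm x) L

lemma trE_mul (x : M) (p q : E x) :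
    trE C x (fun u u' => C.pair x p u * C.pair x q u') = C.pair x p q :=
  haveI : FiniteDimensional ℝ (E x) := VectorBundle.finiteDimensional ℝ F E x
  contract_mul (C.pair x) (C.pair_nondeg x) (C.pair_symm x) p q

lemma trE_sub (x : M) (β β' : E x → E x → ℝ) :
    trE C x (fun u u' => β u u' - β' u u') = trE C x β - trE C x β' :=
  haveI : FiniteDimensional ℝ (E x) := VectorBundle.finiteDimensional ℝ F E x
  contract_sub (C.pair x) (C.pair_nondeg x) β β'

lemma trE_add (x : M) (β β' : E x → E x → ℝ) :
    trE C x (fun u u' => β u u' + β' u u') = trE C x β + trE C x β' :=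
  haveI : FiniteDimensional ℝ (E x) := VectorBundle.finiteDimensional ℝ F E x
  contract_add (C.pair x) (C.pair_nondeg x) β β'

lemma trE_const_mul (x : M) (c : ℝ) (β : E x → E x → ℝ) :
    trE C x (fun u u' => c * β u u') = c * trE C x β :=
  haveI : FiniteDimensional ℝ (E x) := VectorBundle.finiteDimensional ℝ F E x
  contract_const_mul (C.pair x) (C.pair_nondeg x) c β

lemma dot_add_left (x : M) (S S' T : E x →ₗ[ℝ] E x →ₗ[ℝ] E x) :
    dot C x (S + S') T = dot C x S T + dot C x S' T := by
  simp only [dot, LinearMap.add_apply, map_add, trE_add]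

lemma dot_smul_left (x : M) (c : ℝ) (S T : E x →ₗ[ℝ] E x →ₗ[ℝ] E x) :
    dot C x (c • S) T = c * dot C x S T := by
  simp only [dot, LinearMap.smul_apply, map_smul, smul_eq_mul, trE_const_mul]

lemma dot_add_right (x : M) (S T T' : E x →ₗ[ℝ] E x →ₗ[ℝ] E x) :
    dot C x S (T + T') = dot C x S T + dot C x S T' := by
  simp only [dot, LinearMap.add_apply, map_add, trE_add]

lemma dot_smul_right (x : M) (c : ℝ) (S T : E x →ₗ[ℝ] E x →ₗ[ℝ] E x) :
    dot C x S (c • T) = c * dot C x S T := by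
  simp only [dot, LinearMap.smul_apply, map_smul, smul_eq_mul, trE_const_mul]

variable {G} in
lemma IsProlongation.trE_mul_right {x : M} {S : E x →ₗ[ℝ] E x →ₗ[ℝ] E x}
    (hS : G.IsProlongation x S) (u p q : E x) :
    trE C x (fun v v' => C.pair x (S u v) p * C.pair x q v') = C.pair x (S u q) p := by
  have h : ∀ v, C.pair x (S u v) p = C.pair x (-S u p) v := fun v => by
    rw [hS.1, C.pair_symm, map_neg, LinearMap.neg_apply]
  simp only [h, trE_mul]

variable {G} in
lemma IsProlongation.trE_mul_left {x : M} {T : E x →ₗ[ℝ] E x →ₗ[ℝ] E x}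
    (hT : G.IsProlongation x T) (u p q : E x) :
    trE C x (fun v v' => C.pair x q v * C.pair x p (T u v')) = C.pair x (T u q) p := by
  have h : ∀ v, C.pair x p (T u v) = C.pair x (-T u p) v := fun v => by
    rw [map_neg, LinearMap.neg_apply, hT.1, neg_neg]
  simp only [h, trE_mul]
  rw [map_neg, hT.1 u q, C.pair_symm x q]

lemma dot_wedgeMap {x : M} {S : E x →ₗ[ℝ] E x →ₗ[ℝ] E x} (hS : G.IsProlongation x S)
    (α β γ : E x) : dot C x S (wedgeMap C x α β γ) = 2 * C.pair x (S α β) γ := by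
  have h1 := fun u p q => hS.trE_mul_right (G := G) u p q
  have h2 : ∀ u u' : E x, trE C x (fun v v' => C.pair x (S u v) (wedgeMap C x α β γ u' v'))
      = (2 * C.pair x (S u β) γ) * C.pair x α u' := fun u u' => by
    have : ∀ v v', C.pair x (S u v) (wedgeMap C x α β γ u' v') = C.pair x α u' *
        (C.pair x (S u v) γ * C.pair x β v' - C.pair x (S u v) β * C.pair x γ v') := by
      intro v v'
      simp only [wedgeMap_apply, map_smul, map_sub, smul_eq_mul]; ring
    simp only [this, trE_const_mul, trE_sub, h1]
    rw [hS.1 u γ, C.pair_symm x γ]; ring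
  simp only [dot, h2]
  have h3 : ∀ u u', 2 * C.pair x (S u β) γ * C.pair x α u'
      = 2 * (C.pair x (((C.pair x γ ∘ₗ S.flip β)).smulRight α u) u') := fun u u' => by
    simp [C.pair_symm x γ]; ring
  simp only [h3, trE_const_mul, trE_eq_trace]
  have : FiniteDimensional ℝ (E x) := VectorBundle.finiteDimensional ℝ F E x
  rw [trace_smulRight]
  simp [C.pair_symm x γ]

lemma dot_hookMap {x : M} {S : E x →ₗ[ℝ] E x →ₗ[ℝ] E x} (hS : G.IsProlongation x S)
    (α β γ : E x) : dot C x S (hookMap C x α β γ) = 2 * C.pair x (S α β) γ := by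
  simp only [hookMap, dot_add_right, dot_smul_right, G.dot_wedgeMap hS]
  linear_combination -(2 / 3 : ℝ) * hS.2.2 α β γ

lemma dot_chiMap_right {ε : ℤˣ} {x : M} {S : E x →ₗ[ℝ] E x →ₗ[ℝ] E x}
    (hS : G.IsProlongation x S) {f : E x} (hf : f ∈ G.eig ε x) :
    dot C x S (G.chiMap ε x f) = -2 * LinearMap.trace ℝ (E x) (S.flip f) := by
  have h1 := fun u p q => hS.trE_mul_right (G := G) u p q
  have h2 : ∀ u u' : E x, trE C x (fun v v' => C.pair x (S u v) (G.chiMap ε x f u' v'))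
      = -2 * C.pair x (S.flip f u) u' := fun u u' => by
    simp only [chiMap_apply, map_smul, map_sub, smul_eq_mul]
    have : ∀ v v', C.pair x (G.proj ε x u') v' * C.pair x (S u v) f
        - C.pair x f v' * C.pair x (S u v) (G.proj ε x u')
      = C.pair x (S u v) f * C.pair x (G.proj ε x u') v'
        - C.pair x (S u v) (G.proj ε x u') * C.pair x f v' := by
      intro v v'; ring
    simp only [this, trE_sub, h1]
    rw [hS.1, ← G.pair_proj, C.pair_symm x _ (S u f), ← G.pair_proj, hS.proj_apply,
      G.proj_of_mem hf, LinearMap.flip_apply]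
    ring
  simp only [dot, h2, trE_const_mul, trE_eq_trace]

lemma dot_chiMap_left {ε : ℤˣ} {x : M} {T : E x →ₗ[ℝ] E x →ₗ[ℝ] E x}
    (hT : G.IsProlongation x T) {f : E x} (hf : f ∈ G.eig ε x) :
    dot C x (G.chiMap ε x f) T = -2 * LinearMap.trace ℝ (E x) (T.flip f) := by
  have h1 := fun u p q => hT.trE_mul_left (G := G) u p q
  have h2 : ∀ u u' : E x, trE C x (fun v v' => C.pair x (G.chiMap ε x f u v) (T u' v'))
      = -2 * C.pair x u (T.flip f u') := fun u u' => by
    simp only [chiMap_apply, map_smul, map_sub, smul_eq_mul, LinearMap.sub_apply,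
      LinearMap.smul_apply]
    simp only [trE_sub, h1]
    rw [hT.1, G.pair_proj, hT.proj_apply, G.proj_of_mem hf, C.pair_symm x (T u' f), G.pair_proj,
      hT.proj_apply, G.proj_of_mem hf, LinearMap.flip_apply]
    ring
  simp only [dot, h2, trE_const_mul, trE_eq_trace_right]

variable {G} in
/-- A section of the prolongation that is orthogonal to the kernel of the trace is determined by
its trace. -/
lemma IsProlongation.apply_of_orthogonal (hd : d ≠ 1) {x : M} {S : E x →ₗ[ℝ] E x →ₗ[ℝ] E x}
    (hS : G.IsProlongation x S) (e : E x)
    (htr : ∀ v, LinearMap.trace ℝ (E x) (S.flip v) = -C.pair x e v)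
    (hort : ∀ T : E x →ₗ[ℝ] E x →ₗ[ℝ] E x, G.IsProlongation x T →
      (∀ v, LinearMap.trace ℝ (E x) (T.flip v) = 0) → dot C x S T = 0)
    {ε : ℤˣ} {u v : E x} (hu : u ∈ G.eig ε x) (hv : v ∈ G.eig ε x) :
    S u v = (1 / ((d : ℝ) - 1)) • G.chiMap ε x (G.proj ε x e) u v := by
  have hd' : (d : ℝ) - 1 ≠ 0 := sub_ne_zero.2 (by exact_mod_cast hd)
  refine G.eq_of_pair_eig (hS.mem u hv) (Submodule.smul_mem _ _ (sub_mem
    (Submodule.smul_mem _ _ (G.proj_mem _ _ _)) (Submodule.smul_mem _ _ (G.proj_mem _ _ _))))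
    fun w hw => ?_
  set f : E x := C.pair x u w • v - C.pair x u v • w with hf
  have hfm : f ∈ G.eig ε x := sub_mem (Submodule.smul_mem _ _ hv) (Submodule.smul_mem _ _ hw)
  have h := hort (hookMap C x u v w + (1 / ((d : ℝ) - 1)) • G.chiMap ε x f)
    ((G.isProlongation_hookMap hu hv hw).add G ((G.isProlongation_chiMap hfm).smul G _))
    fun z => by
      have : (hookMap C x u v w + (1 / ((d : ℝ) - 1)) • G.chiMap ε x f).flip z
        = (hookMap C x u v w).flip z + (1 / ((d : ℝ) - 1)) • (G.chiMap ε x f).flip z := rfl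
      rw [this, map_add, map_smul, trace_hookMap, G.trace_chiMap ε x hfm, hf]
      simp only [map_sub, map_smul, LinearMap.sub_apply, LinearMap.smul_apply, smul_eq_mul]
      field_simp
      ring
  rw [dot_add_right, dot_smul_right, G.dot_hookMap hS, G.dot_chiMap_right hS hfm, htr, hf] at h
  simp only [map_sub, map_smul, smul_eq_mul] at h
  simp only [chiMap_apply, map_smul, LinearMap.smul_apply, map_sub, LinearMap.sub_apply,
    smul_eq_mul, G.proj_of_mem hu, G.pair_proj, G.proj_of_mem hv, G.proj_of_mem hw]
  linear_combination (1 / 2) * h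

/-- Existence of the tensor of `IsDivTensor`. -/
lemma exists_isProlongation_trace (hd : d ≠ 1) (x : M) (e : E x) :
    ∃ S : E x →ₗ[ℝ] E x →ₗ[ℝ] E x, G.IsProlongation x S ∧
      (∀ v, LinearMap.trace ℝ (E x) (S.flip v) = -C.pair x e v) ∧
      ∀ T : E x →ₗ[ℝ] E x →ₗ[ℝ] E x, G.IsProlongation x T →
        (∀ v, LinearMap.trace ℝ (E x) (T.flip v) = 0) → dot C x S T = 0 := by
  have hd' : (d : ℝ) - 1 ≠ 0 := sub_ne_zero.2 (by exact_mod_cast hd)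
  refine ⟨(1 / ((d : ℝ) - 1)) •
    (G.chiMap 1 x (G.proj 1 x e) + G.chiMap (-1) x (G.proj (-1) x e)),
    ((G.isProlongation_chiMap (G.proj_mem _ _ _)).add G
      (G.isProlongation_chiMap (G.proj_mem _ _ _))).smul G _, fun v => ?_, fun T hT h => ?_⟩
  · have : ((1 / ((d : ℝ) - 1)) •
        (G.chiMap 1 x (G.proj 1 x e) + G.chiMap (-1) x (G.proj (-1) x e))).flip v
      = (1 / ((d : ℝ) - 1)) •
        ((G.chiMap 1 x (G.proj 1 x e)).flip v + (G.chiMap (-1) x (G.proj (-1) x e)).flip v) := rfl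
    rw [this, map_smul, map_add, G.trace_chiMap _ x (G.proj_mem _ _ _),
      G.trace_chiMap _ x (G.proj_mem _ _ _), smul_eq_mul]
    have h := congrArg (fun u => C.pair x u v) (G.proj_add x e)
    simp only [map_add, LinearMap.add_apply] at h
    rw [← h]
    field_simp
    ring
  · rw [dot_smul_left, dot_add_left, G.dot_chiMap_left hT (G.proj_mem _ _ _),
      G.dot_chiMap_left hT (G.proj_mem _ _ _), h, h]
    simp

end GenMetric
end GenGeom

namespace GenGeom

variable {d : ℕ} {M : Type*} [TopologicalSpace M] [ChartedSpace (EuclideanSpace ℝ (Fin d)) M]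
  [IsManifold (𝓡 d) ∞ M]

section SmoothFunctions

variable {f f' : M → ℝ}

lemma SmoothFun.mdifferentiableAt (hf : SmoothFun d f) (x : M) :
    MDifferentiableAt (𝓡 d) 𝓘(ℝ, ℝ) f x :=
  (ContMDiff.mdifferentiable hf (by simp)).mdifferentiableAt

lemma dirDeriv_add (X : ∀ x : M, TangentSpace (𝓡 d) x) (hf : SmoothFun d f)
    (hf' : SmoothFun d f') (x : M) :
    dirDeriv X (fun y => f y + f' y) x = dirDeriv X f x + dirDeriv X f' x := by
  simp only [dirDeriv]
  rw [mvfderiv_fun_add (hf.mdifferentiableAt x) (hf'.mdifferentiableAt x)]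
  rfl

lemma dirDeriv_mul (X : ∀ x : M, TangentSpace (𝓡 d) x) (hf : SmoothFun d f)
    (hf' : SmoothFun d f') (x : M) :
    dirDeriv X (fun y => f y * f' y) x = f x * dirDeriv X f' x + f' x * dirDeriv X f x := by
  simp only [dirDeriv]
  rw [mvfderiv_fun_mul (hf.mdifferentiableAt x) (hf'.mdifferentiableAt x)]
  rfl

lemma dirDeriv_const (X : ∀ x : M, TangentSpace (𝓡 d) x) (c : ℝ) (x : M) :
    dirDeriv X (fun _ => c) x = 0 := by
  simp only [dirDeriv]
  rw [mvfderiv_const]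
  rfl

lemma dirDeriv_const_mul (X : ∀ x : M, TangentSpace (𝓡 d) x) (c : ℝ) (hf : SmoothFun d f)
    (x : M) : dirDeriv X (fun y => c * f y) x = c * dirDeriv X f x := by
  rw [dirDeriv_mul X (f := fun _ => c) contMDiff_const hf, dirDeriv_const]
  ring

end SmoothFunctions

section Fields

variable {X Y : ∀ x : M, TangentSpace (𝓡 d) x}

lemma SmoothField.mdifferentiableAt (hX : SmoothField X) (x : M) :
    MDifferentiableAt (𝓡 d) ((𝓡 d).prod 𝓘(ℝ, EuclideanSpace ℝ (Fin d)))
      (fun x => TotalSpace.mk' (EuclideanSpace ℝ (Fin d)) x (X x)) x :=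
  (ContMDiff.mdifferentiable hX (by simp)).mdifferentiableAt

lemma SmoothField.add (hX : SmoothField X) (hY : SmoothField Y) :
    SmoothField (fun x => X x + Y x) := ContMDiff.add_section hX hY

lemma SmoothField.sub (hX : SmoothField X) (hY : SmoothField Y) :
    SmoothField (fun x => X x - Y x) := ContMDiff.sub_section hX hY

lemma SmoothField.const_smul (c : ℝ) (hX : SmoothField X) :
    SmoothField (fun x => c • X x) := ContMDiff.const_smul_section hX

variable (cov : CovariantDerivative (𝓡 d) (EuclideanSpace ℝ (Fin d))
    (TangentSpace (𝓡 d) : M → Type _))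

lemma cov_add (hX : SmoothField X) (hY : SmoothField Y) (x : M) :
    cov (fun y => X y + Y y) x = cov X x + cov Y x :=
  (cov.isCovariantDerivativeOn (s := Set.univ)).add (hX.mdifferentiableAt x)
    (hY.mdifferentiableAt x)

lemma cov_const_smul (c : ℝ) (hX : SmoothField X) (x : M) :
    cov (fun y => c • X y) x = c • cov X x :=
  (cov.isCovariantDerivativeOn (s := Set.univ)).smul_const c (hX.mdifferentiableAt x)

end Fields

variable {F : Type*} [NormedAddCommGroup F] [NormedSpace ℝ F]
  {E : M → Type*} [TopologicalSpace (TotalSpace F E)]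
  [∀ x, AddCommGroup (E x)] [∀ x, Module ℝ (E x)] [∀ x, TopologicalSpace (E x)]
  [FiberBundle F E] [VectorBundle ℝ F E]

section Sections

variable {u v : ∀ x : M, E x}

lemma SmoothSection.add [ContMDiffVectorBundle ∞ F E (𝓡 d)] (hu : SmoothSection d F u)
    (hv : SmoothSection d F v) :
    SmoothSection d F (fun x => u x + v x) := ContMDiff.add_section hu hv

lemma SmoothSection.sub [ContMDiffVectorBundle ∞ F E (𝓡 d)] (hu : SmoothSection d F u)
    (hv : SmoothSection d F v) :
    SmoothSection d F (fun x => u x - v x) := ContMDiff.sub_section hu hv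

lemma SmoothSection.const_smul [ContMDiffVectorBundle ∞ F E (𝓡 d)] (c : ℝ)
    (hu : SmoothSection d F u) :
    SmoothSection d F (fun x => c • u x) := ContMDiff.const_smul_section hu

lemma SmoothSection.smul [ContMDiffVectorBundle ∞ F E (𝓡 d)] {f : M → ℝ} (hf : SmoothFun d f)
    (hu : SmoothSection d F u) :
    SmoothSection d F (fun x => f x • u x) := ContMDiff.smul_section hf hu

/-- Every vector is the value of a smooth section. -/
lemma exists_smoothSection [T2Space M] [ContMDiffVectorBundle ∞ F E (𝓡 d)] {x₀ : M} (v₀ : E x₀) :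
    ∃ v : ∀ x : M, E x, SmoothSection d F v ∧ v x₀ = v₀ := by
  obtain ⟨s, hs, hv⟩ := FiberBundle.exists_contMDiffOn_extend (k := ∞) (𝓡 d) F v₀
  have hs' : interior s ∈ nhds x₀ := interior_mem_nhds.2 hs
  obtain ⟨ψ, -, hψ⟩ := (SmoothBumpFunction.nhds_basis_tsupport (I := 𝓡 d) x₀).mem_iff.1 hs'
  refine ⟨fun x => ψ x • FiberBundle.extend F v₀ x, ?_, ?_⟩
  · exact ContMDiffOn.smul_section_of_tsupport
      (ψ := fun x => ψ x) (ψ.contMDiff.contMDiffOn) isOpen_interior hψ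
      (hv.mono interior_subset)
  · simp

end Sections

lemma exists_smoothField [T2Space M] {x₀ : M} (v₀ : TangentSpace (𝓡 d) x₀) :
    ∃ X : ∀ x : M, TangentSpace (𝓡 d) x, SmoothField X ∧ X x₀ = v₀ :=
  exists_smoothSection (F := EuclideanSpace ℝ (Fin d)) v₀

namespace GenMetric

variable {C : ExactCourantAlgebroid d F E} (G : GenMetric C)
  [FiniteDimensional ℝ F] [ContMDiffVectorBundle ∞ F E (𝓡 d)]

lemma smooth_proj (ε : ℤˣ) {u : ∀ x : M, E x} (hu : SmoothSection d F u) :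
    SmoothSection d F (fun x => G.proj ε x (u x)) :=
  (hu.add ((G.smooth u hu).const_smul (sg ε))).const_smul (1 / 2)

lemma smooth_lift [T2Space M] (ε : ℤˣ) {X : ∀ x : M, TangentSpace (𝓡 d) x}
    (hX : SmoothField X) : SmoothSection d F (fun x => G.lift ε x (X x)) := by
  intro x₀
  set t := trivializationAt (EuclideanSpace ℝ (Fin d)) (TangentSpace (𝓡 d) : M → Type _) x₀
  have hx₀ : x₀ ∈ t.baseSet := FiberBundle.mem_baseSet_trivializationAt' x₀
  -- sections of the eigenbundle which form a frame near `x₀`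
  choose u hu hux using fun i : Fin d => exists_smoothSection (d := d) (F := F)
    (G.lift ε x₀ (t.symm x₀ (EuclideanSpace.single i (1 : ℝ))))
  set p : Fin d → ∀ x : M, E x := fun i x => G.proj ε x (u i x) with hp
  have hps : ∀ i, SmoothSection d F (p i) := fun i => G.smooth_proj ε (hu i)
  have hpm : ∀ i x, p i x ∈ G.eig ε x := fun i x => G.proj_mem _ _ _
  have hpf : ∀ i, SmoothField (fun x => C.anchor x (p i x)) := fun i =>
    C.anchor_smooth _ (hps i)
  let q : Fin d → M → EuclideanSpace ℝ (Fin d) := fun i x => (t ⟨x, C.anchor x (p i x)⟩).2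
  have hq : ∀ i, ContMDiffAt (𝓡 d) 𝓘(ℝ, EuclideanSpace ℝ (Fin d)) ∞ (q i) x₀ := fun i =>
    (t.contMDiffAt_section_iff hx₀).1 ((hpf i) x₀)
  let L : M → (EuclideanSpace ℝ (Fin d) →L[ℝ] EuclideanSpace ℝ (Fin d)) := fun x =>
    ∑ i, (EuclideanSpace.proj i : EuclideanSpace ℝ (Fin d) →L[ℝ] ℝ).smulRight (q i x)
  have hLa : ∀ x c, L x c = ∑ i, c i • q i x := fun x c => by
    simp [L]
  have hL0 : L x₀ = ContinuousLinearMap.id ℝ _ := by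
    ext c : 1
    rw [hLa]
    have : ∀ i, q i x₀ = EuclideanSpace.single i (1 : ℝ) := fun i => by
      simp only [q, hp, hux, G.proj_of_mem (G.lift_mem _ _ _), G.anchor_lift]
      exact congrArg Prod.snd (t.apply_mk_symm hx₀ _)
    simp only [this]
    ext j
    simp [Pi.single_apply]
  have hLs : ContMDiffAt (𝓡 d) 𝓘(ℝ, EuclideanSpace ℝ (Fin d) →L[ℝ] EuclideanSpace ℝ (Fin d)) ∞
      L x₀ := by
    refine ContMDiffAt.sum fun i _ => ?_
    exact ((ContinuousLinearMap.smulRightL ℝ (EuclideanSpace ℝ (Fin d))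
      (EuclideanSpace ℝ (Fin d)) (EuclideanSpace.proj i)).contMDiff.contMDiffAt).comp x₀ (hq i)
  let c : M → EuclideanSpace ℝ (Fin d) := fun x => (L x).inverse (t ⟨x, X x⟩).2
  have hc : ContMDiffAt (𝓡 d) 𝓘(ℝ, EuclideanSpace ℝ (Fin d)) ∞ c x₀ := by
    refine ContMDiffAt.clm_apply ?_ ((t.contMDiffAt_section_iff hx₀).1 (hX x₀))
    refine ContMDiffAt.comp x₀ (g := ContinuousLinearMap.inverse) ?_ hLs
    rw [hL0]
    exact (contDiffAt_map_inverse
      (ContinuousLinearEquiv.refl ℝ (EuclideanSpace ℝ (Fin d)))).contMDiffAt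
  have hci : ∀ i, ContMDiffAt (𝓡 d) 𝓘(ℝ, ℝ) ∞ (fun x => c x i) x₀ := fun i =>
    ((EuclideanSpace.proj i : EuclideanSpace ℝ (Fin d) →L[ℝ] ℝ).contMDiff.contMDiffAt).comp x₀ hc
  have hinv : ∀ᶠ x in nhds x₀, L x ∈ Set.range
      (fun e : EuclideanSpace ℝ (Fin d) ≃L[ℝ] EuclideanSpace ℝ (Fin d) =>
        (e : EuclideanSpace ℝ (Fin d) →L[ℝ] EuclideanSpace ℝ (Fin d))) := by
    refine hLs.continuousAt.eventually_mem ?_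
    rw [hL0]
    exact ContinuousLinearEquiv.nhds (ContinuousLinearEquiv.refl ℝ (EuclideanSpace ℝ (Fin d)))
  have hsum : ContMDiffAt (𝓡 d) ((𝓡 d).prod 𝓘(ℝ, F)) ∞
      (fun x => TotalSpace.mk' F x (∑ i, c x i • p i x)) x₀ :=
    ContMDiffAt.sum_section fun i _ => ContMDiffAt.smul_section (hci i) (hps i x₀)
  refine hsum.congr_of_eventuallyEq ?_
  filter_upwards [hinv, t.open_baseSet.mem_nhds hx₀] with x hx hxt
  obtain ⟨e, he⟩ := hx
  have hLc : L x (c x) = (t ⟨x, X x⟩).2 := by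
    simp only [c, ← he, ContinuousLinearMap.inverse_equiv]
    exact e.apply_symm_apply _
  have hXx : X x = ∑ i, c x i • C.anchor x (p i x) := by
    refine (t.linearEquivAt ℝ x hxt).injective ?_
    simp only [map_sum, map_smul, Trivialization.linearEquivAt_apply]
    rw [← hLc, hLa]
  congr 1
  rw [hXx, map_sum]
  exact Finset.sum_congr rfl fun i _ => by rw [map_smul, G.lift_anchor (hpm i x)]

end GenMetric
end GenGeom

namespace GenGeom

variable {d : ℕ} {M : Type*} [TopologicalSpace M] [ChartedSpace (EuclideanSpace ℝ (Fin d)) M]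
  [IsManifold (𝓡 d) ∞ M]
  {F : Type*} [NormedAddCommGroup F] [NormedSpace ℝ F]
  {E : M → Type*} [TopologicalSpace (TotalSpace F E)]
  [∀ x, AddCommGroup (E x)] [∀ x, Module ℝ (E x)] [∀ x, TopologicalSpace (E x)]
  [FiberBundle F E]

section CourantAlgebroid

variable (C : ExactCourantAlgebroid d F E)

lemma ExactCourantAlgebroid.pair_congr_of_anchor {x : M} {k u v : E x} (hk : C.anchor x k = 0)
    (h : C.anchor x u = C.anchor x v) : C.pair x k u = C.pair x k v := by
  obtain ⟨ξ, hξ⟩ := (C.exact_middle x k).1 hk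
  rw [hξ, hξ, h]

lemma ExactCourantAlgebroid.pair_bracket_right {u k v : ∀ x : M, E x}
    (hu : SmoothSection d F u) (hk : SmoothSection d F k) (hv : SmoothSection d F v) (x : M) :
    C.pair x (C.bracket u k x) (v x) =
      dirDeriv (fun y => C.anchor y (u y)) (fun y => C.pair y (k y) (v y)) x
        - C.pair x (k x) (C.bracket u v x) := by
  rw [C.pair_invariant u k v hu hk hv]
  ring

lemma ExactCourantAlgebroid.pair_bracket_left {u k v : ∀ x : M, E x}
    (hu : SmoothSection d F u) (hk : SmoothSection d F k) (hv : SmoothSection d F v) (x : M) :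
    C.pair x (C.bracket k u x) (v x) =
      dirDeriv (fun y => C.anchor y (v y)) (fun y => C.pair y (k y) (u y)) x
        - C.pair x (C.bracket u k x) (v x) := by
  rw [← C.bracket_symm_part k u v hk hu hv, map_add, LinearMap.add_apply]
  ring

/-- `[X, Y] f = X (Y f) - Y (X f)` for anchors of smooth sections. -/
lemma ExactCourantAlgebroid.dirDeriv_anchor_bracket [FiniteDimensional ℝ F] [VectorBundle ℝ F E]
    [ContMDiffVectorBundle ∞ F E (𝓡 d)] [T2Space M] {u v : ∀ x : M, E x} {f : M → ℝ}
    (hu : SmoothSection d F u) (hv : SmoothSection d F v) (hf : SmoothFun d f)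
    (huf : SmoothFun d (dirDeriv (fun y => C.anchor y (u y)) f))
    (hvf : SmoothFun d (dirDeriv (fun y => C.anchor y (v y)) f)) (x : M) :
    dirDeriv (fun y => C.anchor y (C.bracket u v y)) f x =
      dirDeriv (fun y => C.anchor y (u y)) (dirDeriv (fun y => C.anchor y (v y)) f) x
      - dirDeriv (fun y => C.anchor y (v y)) (dirDeriv (fun y => C.anchor y (u y)) f) x := by
  by_cases h0 : C.anchor x (C.bracket u v x) = 0 ∧ C.anchor x (u x) = 0 ∧ C.anchor x (v x) = 0
  · simp [dirDeriv, h0.1, h0.2.1, h0.2.2]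
  obtain ⟨p, hp⟩ : ∃ p : E x, p ≠ 0 := by
    by_contra! h
    exact h0 ⟨by rw [h (C.bracket u v x), map_zero], by rw [h (u x), map_zero],
      by rw [h (v x), map_zero]⟩
  obtain ⟨w, hw, rfl⟩ := exists_smoothSection (d := d) (F := F) p
  have key : ∀ u v : (∀ x : M, E x), SmoothSection d F u → SmoothSection d F v →
      SmoothFun d (dirDeriv (fun y => C.anchor y (v y)) f) →
      C.bracket u (C.bracket v (fun y => f y • w y)) x =
        f x • C.bracket u (C.bracket v w) x
        + dirDeriv (fun y => C.anchor y (u y)) f x • C.bracket v w x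
        + dirDeriv (fun y => C.anchor y (v y)) f x • C.bracket u w x
        + dirDeriv (fun y => C.anchor y (u y)) (dirDeriv (fun y => C.anchor y (v y)) f) x • w x := by
    intro u v hu hv hvf
    have h1 : C.bracket v (fun y => f y • w y) = (fun y => f y • C.bracket v w y)
        + (fun y => dirDeriv (fun y => C.anchor y (v y)) f y • w y) :=
      funext fun y => C.bracket_leibniz f v w hf hv hw y
    have hvw := C.bracket_smooth v w hv hw
    rw [h1, C.bracket_add_right u _ _ hu (SmoothSection.smul hf hvw) (SmoothSection.smul hvf hw),
      Pi.add_apply, C.bracket_leibniz _ _ _ hf hu hvw, C.bracket_leibniz _ _ _ hvf hu hw]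
    abel
  have hj := congrFun (C.bracket_jacobi u v (fun y => f y • w y) hu hv (SmoothSection.smul hf hw)) x
  have hj' := congrFun (C.bracket_jacobi u v w hu hv hw) x
  rw [Pi.add_apply, key u v hu hv hvf, key v u hv hu huf,
    C.bracket_leibniz f _ w hf (C.bracket_smooth u v hu hv) hw, hj', Pi.add_apply] at hj
  refine sub_eq_zero.1 ((smul_eq_zero.1 ?_).resolve_right hp)
  linear_combination (norm := module) -hj

end CourantAlgebroid

namespace GenMetric

variable {C : ExactCourantAlgebroid d F E} (G : GenMetric C)
  [FiniteDimensional ℝ F] [VectorBundle ℝ F E]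

lemma metric_symm (x : M) (X Y : TangentSpace (𝓡 d) x) : G.metric x X Y = G.metric x Y X := by
  simp [metric, C.pair_symm x]

lemma metric_ext {x : M} {X Y : TangentSpace (𝓡 d) x}
    (h : ∀ Z, G.metric x X Z = G.metric x Y Z) : X = Y := by
  rw [← sub_eq_zero]
  exact (G.metric_nondeg x).1 _ fun Z => by rw [map_sub, LinearMap.sub_apply, h, sub_self]

/-- The isomorphism `TM ≅ T*M ⊂ E` determined by `g`, so that `X_± = s X ± vert X`. -/
def vert (x : M) : TangentSpace (𝓡 d) x →ₗ[ℝ] E x :=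
  (1 / 2 : ℝ) • (G.lift 1 x - G.lift (-1) x)

lemma anchor_vert (x : M) (X : TangentSpace (𝓡 d) x) : C.anchor x (G.vert x X) = 0 := by
  simp [vert, G.anchor_lift]

lemma anchor_split (x : M) (X : TangentSpace (𝓡 d) x) : C.anchor x (G.split x X) = X := by
  simp only [split, LinearMap.smul_apply, LinearMap.add_apply, map_smul, map_add, G.anchor_lift]
  module

lemma pair_vert (x : M) (X : TangentSpace (𝓡 d) x) (u : E x) :
    C.pair x (G.vert x X) u = 1 / 2 * G.metric x X (C.anchor x u) := by
  rw [C.pair_congr_of_anchor (G.anchor_vert x X) (G.anchor_lift 1 x (C.anchor x u)).symm, vert]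
  simp only [LinearMap.smul_apply, LinearMap.sub_apply, map_smul, map_sub, smul_eq_mul]
  rw [C.pair_symm x (G.lift (-1) x X), G.pair_eig (G.lift_mem 1 x _) (G.lift_mem (-1) x X),
    sub_zero]
  rfl

lemma lift_eq (ε : ℤˣ) (x : M) (X : TangentSpace (𝓡 d) x) :
    G.lift ε x X = G.split x X + G.vert x (sg ε • X) := by
  simp only [split, vert, LinearMap.smul_apply, LinearMap.sub_apply, LinearMap.add_apply]
  rcases Int.units_eq_one_or ε with rfl | rfl <;> (simp [sg]; module)

lemma pair_lift (ε : ℤˣ) (x : M) (X Y : TangentSpace (𝓡 d) x) :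
    C.pair x (G.lift ε x X) (G.lift ε x Y) = sg ε * G.metric x X Y := by
  have h := G.pair_vert x (sg ε • X) (G.lift ε x Y)
  have h2 : G.vert x (sg ε • X) = (1 / 2 : ℝ) • (G.lift ε x X - G.lift (-ε) x X) := by
    simp only [vert, LinearMap.smul_apply, LinearMap.sub_apply]
    rcases Int.units_eq_one_or ε with rfl | rfl
    · simp [sg]
    · simp [sg]; module
  rw [h2, G.anchor_lift] at h
  simp only [map_smul, map_sub, LinearMap.smul_apply, LinearMap.sub_apply, smul_eq_mul] at h
  rw [C.pair_symm x (G.lift (-ε) x X), G.pair_eig (G.lift_mem ε x _) (G.lift_mem (-ε) x X)] at h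
  linarith

lemma pair_split_split (x : M) (X Y : TangentSpace (𝓡 d) x) :
    C.pair x (G.split x X) (G.split x Y) = 0 := by
  simp only [split, LinearMap.smul_apply, LinearMap.add_apply, map_smul, map_add, G.pair_lift,
    smul_eq_mul, G.pair_eig (ε := 1) (G.lift_mem 1 x X) (G.lift_mem (-1) x Y),
    G.pair_eig (ε := -1) (G.lift_mem (-1) x X) (by rw [neg_neg]; exact G.lift_mem 1 x Y)]
  simp [sg]

lemma metric_anchor {ε : ℤˣ} {x : M} {u v : E x} (hu : u ∈ G.eig ε x) (hv : v ∈ G.eig ε x) :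
    G.metric x (C.anchor x u) (C.anchor x v) = sg ε * C.pair x u v := by
  have h := G.pair_lift ε x (C.anchor x u) (C.anchor x v)
  rw [G.lift_anchor hu, G.lift_anchor hv] at h
  rw [h, ← mul_assoc, sg_mul_self, one_mul]

section Smooth

variable [T2Space M] [ContMDiffVectorBundle ∞ F E (𝓡 d)]
  {X Y Z W : ∀ x : M, TangentSpace (𝓡 d) x}

lemma smooth_metric (hX : SmoothField X) (hY : SmoothField Y) :
    SmoothFun d (fun x => G.metric x (X x) (Y x)) :=
  C.pair_smooth _ _ (G.smooth_lift 1 hX) (G.smooth_lift 1 hY)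

lemma smooth_vert (hX : SmoothField X) : SmoothSection d F (fun x => G.vert x (X x)) :=
  ((G.smooth_lift 1 hX).sub (G.smooth_lift (-1) hX)).const_smul (1 / 2)

lemma smooth_split (hX : SmoothField X) : SmoothSection d F (fun x => G.split x (X x)) :=
  ((G.smooth_lift 1 hX).add (G.smooth_lift (-1) hX)).const_smul (1 / 2)

variable {cov : CovariantDerivative (𝓡 d) (EuclideanSpace ℝ (Fin d))
    (TangentSpace (𝓡 d) : M → Type _)} (hcov : IsLeviCivita G.metric cov)
  {H : ∀ x : M, TangentSpace (𝓡 d) x →ₗ[ℝ] TangentSpace (𝓡 d) x →ₗ[ℝ]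
    TangentSpace (𝓡 d) x →ₗ[ℝ] ℝ} (hH : G.IsThreeForm H)

include hcov in
lemma pair_bracket_vert_right {u v : ∀ x : M, E x} (hu : SmoothSection d F u)
    (hv : SmoothSection d F v) (hW : SmoothField W) (x : M) :
    C.pair x (C.bracket u (fun y => G.vert y (W y)) x) (v x) =
      1 / 2 * (G.metric x (cov W x (C.anchor x (u x))) (C.anchor x (v x))
        + G.metric x (W x) (cov (C.push u) x (C.anchor x (v x)))) := by
  have hpu : SmoothField (C.push u) := C.anchor_smooth u hu
  have hpv : SmoothField (C.push v) := C.anchor_smooth v hv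
  rw [C.pair_bracket_right hu (G.smooth_vert hW) hv]
  simp only [G.pair_vert]
  have h0 := dirDeriv_const_mul (C.push u) (1 / 2) (G.smooth_metric hW hpv) x
  rw [C.anchor_bracket u v hu hv]
  have h1 := hcov.metric (C.push u) W (C.push v) hpu hW hpv x
  have h2 := hcov.torsion_free (C.push u) (C.push v) hpu hpv x
  unfold ExactCourantAlgebroid.push at h0 h1 h2 ⊢
  rw [h0, h1, ← h2, map_sub]
  ring

include hcov in
lemma pair_bracket_vert_left {u v : ∀ x : M, E x} (hu : SmoothSection d F u)
    (hv : SmoothSection d F v) (hW : SmoothField W) (x : M) :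
    C.pair x (C.bracket (fun y => G.vert y (W y)) u x) (v x) =
      1 / 2 * (G.metric x (cov W x (C.anchor x (v x))) (C.anchor x (u x))
        - G.metric x (cov W x (C.anchor x (u x))) (C.anchor x (v x))) := by
  have hpu : SmoothField (C.push u) := C.anchor_smooth u hu
  have hpv : SmoothField (C.push v) := C.anchor_smooth v hv
  rw [C.pair_bracket_left hu (G.smooth_vert hW) hv, G.pair_bracket_vert_right hcov hu hv hW]
  simp only [G.pair_vert]
  have h0 := dirDeriv_const_mul (C.push v) (1 / 2) (G.smooth_metric hW hpu) x
  have h1 := hcov.metric (C.push v) W (C.push u) hpv hW hpu x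
  unfold ExactCourantAlgebroid.push at h0 h1 ⊢
  rw [h0, h1]
  ring

include hcov hH in
/-- The component of the bracket along `E_±` is the Bismut connection with torsion `±H`. -/
lemma pair_bracket_lift (ε : ℤˣ) (hX : SmoothField X) (hY : SmoothField Y) (hZ : SmoothField Z)
    (x : M) :
    C.pair x (C.bracket (fun y => G.lift (-ε) y (X y)) (fun y => G.lift ε y (Y y)) x)
        (G.lift ε x (Z x)) =
      1 / 2 * H x (X x) (Y x) (Z x) + sg ε * G.metric x (cov Y x (X x)) (Z x) := by
  have hX' := hX.const_smul (sg (-ε))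
  have hY' := hY.const_smul (sg ε)
  have e1 : (fun y => G.lift (-ε) y (X y))
      = (fun y => G.split y (X y)) + (fun y => G.vert y (sg (-ε) • X y)) :=
    funext fun y => G.lift_eq (-ε) y (X y)
  have e2 : (fun y => G.lift ε y (Y y))
      = (fun y => G.split y (Y y)) + (fun y => G.vert y (sg ε • Y y)) :=
    funext fun y => G.lift_eq ε y (Y y)
  have t1 := G.pair_bracket_vert_left hcov (G.smooth_lift ε hY) (G.smooth_lift ε hZ) hX' x
  have t2 := G.pair_bracket_vert_right hcov (G.smooth_split hX) (G.smooth_lift ε hZ) hY' x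
  have t3 : C.pair x (C.bracket (fun y => G.split y (X y)) (fun y => G.split y (Y y)) x)
      (G.lift ε x (Z x)) = 1 / 2 * H x (X x) (Y x) (Z x)
        + 1 / 2 * sg ε * G.metric x (Z x) (cov Y x (X x) - cov X x (Y x)) := by
    rw [G.lift_eq, map_add, hH X Y Z hX hY hZ, C.pair_symm x _ (G.vert x _), G.pair_vert,
      C.anchor_bracket _ _ (G.smooth_split hX) (G.smooth_split hY)]
    simp only [G.anchor_split]
    rw [hcov.torsion_free X Y hX hY, map_smul, LinearMap.smul_apply, smul_eq_mul]
    ring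
  rw [e1, C.bracket_add_left _ _ _ (G.smooth_split hX) (G.smooth_vert hX') (G.smooth_lift ε hY),
    Pi.add_apply, map_add, LinearMap.add_apply, t1]
  rw [e2, C.bracket_add_right _ _ _ (G.smooth_split hX) (G.smooth_split hY) (G.smooth_vert hY'),
    Pi.add_apply, map_add, LinearMap.add_apply, t2, t3, cov_const_smul cov _ hX,
    cov_const_smul cov _ hY]
  have e3 : C.push (fun y => G.split y (X y)) = X := funext fun y => G.anchor_split y (X y)
  simp only [G.anchor_lift, G.anchor_split, e3, sg_neg, _root_.smul_apply, map_smul,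
    LinearMap.smul_apply, smul_eq_mul, map_sub]
  rw [G.metric_symm x (Z x) (cov Y x (X x)), G.metric_symm x (Z x) (cov X x (Y x)),
    G.metric_symm x (Y x)]
  ring

include hH in
lemma threeForm_swap_left (x : M) (X Y Z : TangentSpace (𝓡 d) x) :
    H x X Y Z = -H x Y X Z := by
  obtain ⟨X, hX, rfl⟩ := exists_smoothField X
  obtain ⟨Y, hY, rfl⟩ := exists_smoothField Y
  obtain ⟨Z, hZ, rfl⟩ := exists_smoothField Z
  rw [hH X Y Z hX hY hZ, hH Y X Z hY hX hZ,
    C.pair_bracket_left (G.smooth_split hY) (G.smooth_split hX) (G.smooth_split hZ)]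
  simp only [G.pair_split_split, dirDeriv_const]
  ring

include hH in
lemma threeForm_swap_right (x : M) (X Y Z : TangentSpace (𝓡 d) x) :
    H x X Y Z = -H x X Z Y := by
  obtain ⟨X, hX, rfl⟩ := exists_smoothField X
  obtain ⟨Y, hY, rfl⟩ := exists_smoothField Y
  obtain ⟨Z, hZ, rfl⟩ := exists_smoothField Z
  rw [hH X Y Z hX hY hZ, hH X Z Y hX hZ hY,
    C.pair_bracket_right (G.smooth_split hX) (G.smooth_split hY) (G.smooth_split hZ)]
  simp only [G.pair_split_split, dirDeriv_const]
  rw [C.pair_symm x (G.split x (Y x))]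
  ring

lemma metric_sharpH (x : M) (X Y Z : TangentSpace (𝓡 d) x) :
    G.metric x (G.sharpH H x X Y) Z = H x X Y Z := by
  have : FiniteDimensional ℝ (TangentSpace (𝓡 d) x) :=
    inferInstanceAs (FiniteDimensional ℝ (EuclideanSpace ℝ (Fin d)))
  exact LinearMap.BilinForm.apply_toDual_symm_apply (hB := G.metric_nondeg x) _ _

include hcov hH in
lemma anchor_proj_bracket {ε : ℤˣ} {a b : ∀ x : M, E x} (ha : SmoothSection d F a)
    (ha' : ∀ x, a x ∈ G.eig ε x) (hb : SmoothSection d F b) (hb' : ∀ x, b x ∈ G.eig (-ε) x)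
    (x : M) :
    C.anchor x (G.proj ε x (C.bracket b a x)) = cov (C.push a) x (C.push b x)
      + (sg ε / 2) • G.sharpH H x (C.push b x) (C.push a x) := by
  refine G.metric_ext fun Z => ?_
  obtain ⟨Z, hZ, rfl⟩ := exists_smoothField Z
  have h := G.pair_bracket_lift hcov hH ε (C.anchor_smooth b hb) (C.anchor_smooth a ha) hZ x
  have e1 : (fun y => G.lift (-ε) y (C.anchor y (b y))) = b :=
    funext fun y => G.lift_anchor (hb' y)
  have e2 : (fun y => G.lift ε y (C.anchor y (a y))) = a :=
    funext fun y => G.lift_anchor (ha' y)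
  rw [e1, e2] at h
  have h2 := G.metric_anchor (G.proj_mem ε x (C.bracket b a x)) (G.lift_mem ε x (Z x))
  rw [G.anchor_lift, G.pair_proj, G.proj_of_mem (G.lift_mem ε x (Z x)), h] at h2
  rw [h2, map_add, LinearMap.add_apply, map_smul, LinearMap.smul_apply, metric_sharpH, smul_eq_mul]
  unfold ExactCourantAlgebroid.push
  linear_combination (G.metric x ((cov (fun y => C.anchor y (a y)) x) (C.anchor x (b x))) (Z x))
    * sg_mul_self ε

include hcov hH in
lemma anchor_proj_neg_bracket {ε : ℤˣ} {a b : ∀ x : M, E x} (ha : SmoothSection d F a)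
    (ha' : ∀ x, a x ∈ G.eig ε x) (hb : SmoothSection d F b) (hb' : ∀ x, b x ∈ G.eig (-ε) x)
    (x : M) :
    C.anchor x (G.proj (-ε) x (C.bracket b a x)) = -(cov (C.push b) x (C.push a x)
      + (sg ε / 2) • G.sharpH H x (C.push b x) (C.push a x)) := by
  have h := congrArg (C.anchor x) (G.proj_add_neg ε x (C.bracket b a x))
  have h1 := hcov.torsion_free (C.push b) (C.push a) (C.anchor_smooth b hb)
    (C.anchor_smooth a ha) x
  have h2 : C.anchor x (C.bracket b a x)
      = VectorField.mlieBracket (𝓡 d) (C.push b) (C.push a) x := C.anchor_bracket b a hb ha x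
  rw [map_add, G.anchor_proj_bracket hcov hH ha ha' hb hb', h2, ← h1] at h
  rw [eq_neg_iff_add_eq_zero]
  linear_combination (norm := module) h

include hcov hH in
lemma smooth_sharpH (hX : SmoothField X) (hY : SmoothField Y) :
    SmoothField (fun x => G.sharpH H x (X x) (Y x)) := by
  have hb := G.smooth_lift (-1) hX
  have ha := G.smooth_lift 1 hY
  have h := ((C.anchor_smooth _ (G.smooth_proj 1 (C.bracket_smooth _ _ hb ha))).sub
    (hcov.smooth X Y hX hY)).const_smul 2
  convert h using 2 with x
  rw [G.anchor_proj_bracket hcov hH ha (fun y => G.lift_mem 1 y (Y y)) hb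
    (fun y => G.lift_mem (-1) y (X y))]
  have e1 : C.push (fun y => G.lift (-1) y (X y)) = X := funext fun y => G.anchor_lift _ y _
  have e2 : C.push (fun y => G.lift 1 y (Y y)) = Y := funext fun y => G.anchor_lift _ y _
  rw [e1, e2, add_sub_cancel_left, smul_smul]
  simp [sg]

end Smooth

end GenMetric
end GenGeom

namespace GenGeom

namespace GenMetric

variable {d : ℕ} {M : Type*} [TopologicalSpace M] [ChartedSpace (EuclideanSpace ℝ (Fin d)) M]
  [IsManifold (𝓡 d) ∞ M]
  {F : Type*} [NormedAddCommGroup F] [NormedSpace ℝ F]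
  {E : M → Type*} [TopologicalSpace (TotalSpace F E)]
  [∀ x, AddCommGroup (E x)] [∀ x, Module ℝ (E x)] [∀ x, TopologicalSpace (E x)]
  [FiberBundle F E]
  {C : ExactCourantAlgebroid d F E} (G : GenMetric C)
  [FiniteDimensional ℝ F] [VectorBundle ℝ F E] [T2Space M] [ContMDiffVectorBundle ∞ F E (𝓡 d)]
  {cov : CovariantDerivative (𝓡 d) (EuclideanSpace ℝ (Fin d))
    (TangentSpace (𝓡 d) : M → Type _)}
  {H : ∀ x : M, TangentSpace (𝓡 d) x →ₗ[ℝ] TangentSpace (𝓡 d) x →ₗ[ℝ]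
    TangentSpace (𝓡 d) x →ₗ[ℝ] ℝ}

section Riemannian

variable (hcov : IsLeviCivita G.metric cov)

include hcov in
/-- The curvature of the Levi-Civita connection is skew for `g`. -/
lemma riem_swap {a b v w : ∀ x : M, E x} (ha : SmoothSection d F a) (hb : SmoothSection d F b)
    (hv : SmoothSection d F v) (hw : SmoothSection d F w) (x : M) :
    G.riem cov (C.push a) (C.push b) (C.push v) (C.push w) x
      = G.riem cov (C.push b) (C.push a) (C.push w) (C.push v) x := by
  have hA : SmoothField (C.push a) := C.anchor_smooth a ha
  have hB : SmoothField (C.push b) := C.anchor_smooth b hb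
  have hV : SmoothField (C.push v) := C.anchor_smooth v hv
  have hW : SmoothField (C.push w) := C.anchor_smooth w hw
  have hAB : SmoothField (C.push (C.bracket a b)) :=
    C.anchor_smooth _ (C.bracket_smooth a b ha hb)
  have hABe : C.push (C.bracket a b) x
      = VectorField.mlieBracket (𝓡 d) (C.push a) (C.push b) x := C.anchor_bracket a b ha hb x
  generalize hAe : C.push a = A at *
  generalize hBe : C.push b = B at *
  generalize C.push v = V at *
  generalize C.push w = W at *
  have hf := G.smooth_metric hV hW
  have hd : ∀ X, SmoothField X → dirDeriv X (fun y => G.metric y (V y) (W y)) =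
      fun y => G.metric y (cov V y (X y)) (W y) + G.metric y (V y) (cov W y (X y)) :=
    fun X hX => funext fun y => hcov.metric X V W hX hV hW y
  have hs : ∀ X, SmoothField X → SmoothFun d (dirDeriv X (fun y => G.metric y (V y) (W y))) :=
    fun X hX => by
      rw [hd X hX]
      exact ContMDiff.add (G.smooth_metric (hcov.smooth X V hX hV) hW)
        (G.smooth_metric hV (hcov.smooth X W hX hW))
  have hdd : ∀ X Y, SmoothField X → SmoothField Y →
      dirDeriv Y (dirDeriv X (fun y => G.metric y (V y) (W y))) x =
        G.metric x (cov (fun y => cov V y (X y)) x (Y x)) (W x)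
        + G.metric x (cov V x (X x)) (cov W x (Y x))
        + G.metric x (cov V x (Y x)) (cov W x (X x))
        + G.metric x (V x) (cov (fun y => cov W y (X y)) x (Y x)) := fun X Y hX hY => by
    rw [hd X hX, dirDeriv_add Y (G.smooth_metric (hcov.smooth X V hX hV) hW)
      (G.smooth_metric hV (hcov.smooth X W hX hW)),
      hcov.metric Y _ W hY (hcov.smooth X V hX hV) hW,
      hcov.metric Y V _ hY hV (hcov.smooth X W hX hW)]
    ring
  have h := C.dirDeriv_anchor_bracket ha hb hf (by
    have := hs A hA; rwa [← hAe] at this) (by have := hs B hB; rwa [← hBe] at this) x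
  change dirDeriv (C.push (C.bracket a b)) _ x =
    dirDeriv (C.push a) (dirDeriv (C.push b) _) x
      - dirDeriv (C.push b) (dirDeriv (C.push a) _) x at h
  rw [hAe, hBe, hdd A B hA hB, hdd B A hB hA, hcov.metric _ V W hAB hV hW, hABe] at h
  simp only [riem]
  rw [VectorField.mlieBracket_swap_apply (V := B)]
  simp only [map_sub, map_neg, LinearMap.sub_apply, LinearMap.neg_apply]
  simp only [G.metric_symm x (V x)] at h
  linarith

variable (hH : G.IsThreeForm H)
  {A B V W σ : ∀ x : M, TangentSpace (𝓡 d) x}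
include hcov hH

lemma covH_eq (hA : SmoothField A) (hB : SmoothField B) (hV : SmoothField V) (hW : SmoothField W)
    (x : M) : covH cov H A B V W x =
      G.metric x (cov (fun y => G.sharpH H y (B y) (V y)) x (A x)) (W x)
        - H x (cov B x (A x)) (V x) (W x) - H x (B x) (cov V x (A x)) (W x) := by
  have h := hcov.metric A _ W hA (G.smooth_sharpH hcov hH hB hV) hW x
  simp only [metric_sharpH] at h
  rw [covH, h]
  ring

/-- The curvature of the pair of Bismut-type connections `∇ + (s/2) h` (along `B`) and
`∇ + (s/6) h` (along `A`), where `h = g⁻¹H`, with an additional term `σ` along `A`. -/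
lemma metric_mixed_curvature {s : ℝ} (hs : s * s = 1) (hA : SmoothField A) (hB : SmoothField B)
    (hV : SmoothField V) (hW : SmoothField W) (hσ : SmoothField σ) (x : M) :
    G.metric x (
      (cov (fun y => cov V y (A y) + (s / 6) • G.sharpH H y (A y) (V y) + σ y) x (B x)
        + (s / 2) • G.sharpH H x (B x)
          (cov V x (A x) + (s / 6) • G.sharpH H x (A x) (V x) + σ x))
      - (cov (fun y => cov V y (B y) + (s / 2) • G.sharpH H y (B y) (V y)) x (A x)
        + (s / 6) • G.sharpH H x (A x) (cov V x (B x) + (s / 2) • G.sharpH H x (B x) (V x)))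
      - (cov V x (VectorField.mlieBracket (𝓡 d) B A x)
        + (s / 6) • G.sharpH H x (cov A x (B x) + (s / 2) • G.sharpH H x (B x) (A x)) (V x)
        + (s / 2) • G.sharpH H x (-(cov B x (A x) + (s / 2) • G.sharpH H x (B x) (A x))) (V x)))
      (W x) =
    G.riem cov B A W V x - s * (1 / 2) * covH cov H A B V W x
      + s * (1 / 6) * covH cov H B A V W x
      - (1 / 12) * G.H2 H x (B x) (W x) (A x) (V x)
      - (1 / 12) * G.H2 H x (W x) (A x) (B x) (V x)
      - (1 / 6) * G.H2 H x (A x) (B x) (V x) (W x)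
      + G.metric x (cov σ x (B x)) (W x) - s / 2 * H x (B x) (W x) (σ x) := by
  have hAV := hcov.smooth A V hA hV
  have hBV := hcov.smooth B V hB hV
  have hhAV := G.smooth_sharpH hcov hH hA hV
  have hhBV := G.smooth_sharpH hcov hH hB hV
  rw [G.covH_eq hcov hH hA hB hV hW, G.covH_eq hcov hH hB hA hV hW,
    cov_add cov (hAV.add (hhAV.const_smul _)) hσ, cov_add cov hAV (hhAV.const_smul _),
    cov_add cov hBV (hhBV.const_smul _), cov_const_smul cov _ hhAV, cov_const_smul cov _ hhBV]
  have r1 : G.H2 H x (B x) (W x) (A x) (V x)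
      = -H x (B x) (G.sharpH H x (A x) (V x)) (W x) := by
    rw [H2, metric_sharpH, G.threeForm_swap_right hH]
  have r2 : G.H2 H x (W x) (A x) (B x) (V x)
      = H x (A x) (G.sharpH H x (B x) (V x)) (W x) := by
    rw [H2, metric_sharpH, G.threeForm_swap_left hH, G.threeForm_swap_right hH, neg_neg]
  have r3 : G.H2 H x (A x) (B x) (V x) (W x)
      = -H x (G.sharpH H x (B x) (A x)) (V x) (W x) := by
    rw [H2, G.metric_symm, metric_sharpH, G.threeForm_swap_right hH, G.threeForm_swap_left hH,
      neg_neg]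
    have : G.sharpH H x (A x) (B x) = -G.sharpH H x (B x) (A x) :=
      G.metric_ext fun Z => by
        rw [map_neg, LinearMap.neg_apply, metric_sharpH, metric_sharpH, G.threeForm_swap_left hH]
    rw [this, map_neg, LinearMap.neg_apply, LinearMap.neg_apply]
  have r4 := G.threeForm_swap_right hH x (B x) (W x) (σ x)
  rw [r1, r2, r3, r4, riem]
  simp only [map_add, map_sub, map_neg, map_smul, LinearMap.add_apply, LinearMap.sub_apply,
    LinearMap.neg_apply, LinearMap.smul_apply, _root_.add_apply, _root_.smul_apply, smul_eq_mul,
    metric_sharpH]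
  linear_combination (1 / 12 * H x (B x) (G.sharpH H x (A x) (V x)) (W x)
    - 1 / 12 * H x (A x) (G.sharpH H x (B x) (V x)) (W x)
    + 1 / 6 * H x (G.sharpH H x (B x) (A x)) (V x) (W x)) * hs

end Riemannian

section Connection

variable (hd : d ≠ 1) (dv : DivOperator C) (e : ∀ x : M, E x)
  (hdv : ∀ v : (∀ x : M, E x), SmoothSection d F v → ∀ x,
    dv.op v x = metricDiv C cov v x - C.pair x (e x) (v x))

include hd hdv in
lemma isDivTensor_divTensor (x : M) : G.IsDivTensor cov dv x (G.divTensor cov dv x) := by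
  obtain ⟨S, h1, h2, h3⟩ := G.exists_isProlongation_trace hd x (e x)
  refine Classical.epsilon_spec (p := G.IsDivTensor cov dv x) ⟨S, h1, fun v hv => ?_, h3⟩
  rw [h2, hdv v hv, sub_eq_add_neg]

include hd hdv in
lemma divTensor_apply {ε : ℤˣ} (x : M) (u : E x) {v : E x} (hv : v ∈ G.eig ε x) :
    G.divTensor cov dv x u v
      = (1 / ((d : ℝ) - 1)) • G.chiMap ε x (G.proj ε x (e x)) u v := by
  obtain ⟨h1, h2, h3⟩ := G.isDivTensor_divTensor hd dv e hdv x
  have h2' : ∀ v, LinearMap.trace ℝ (E x) ((G.divTensor cov dv x).flip v)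
      = -C.pair x (e x) v := fun v => by
    obtain ⟨v, hv, rfl⟩ := exists_smoothSection (d := d) (F := F) v
    have := h2 v hv
    rw [hdv v hv] at this
    linarith
  conv_lhs => rw [← G.proj_add_neg ε x u, map_add, LinearMap.add_apply,
    h1.apply_eq_zero (G.proj_mem (-ε) x u) hv, add_zero,
    h1.apply_of_orthogonal hd (e x) h2' h3 (G.proj_mem ε x u) hv]
  simp only [chiMap_apply, G.proj_of_mem (G.proj_mem ε x u)]

lemma connZero_of_mem {ε : ℤˣ} {v : ∀ x : M, E x} (hv : ∀ x, v x ∈ G.eig ε x) (x : M) (u : E x) :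
    G.connZero cov H v x u = G.lift ε x (cov (C.push v) x (C.anchor x u)
      + (sg ε / 6) • G.sharpH H x (C.anchor x (G.proj ε x u)) (C.push v x)
      + (sg ε / 2) • G.sharpH H x (C.anchor x (G.proj (-ε) x u)) (C.push v x)) := by
  have h1 : G.connZeroPart cov H ε v x u = G.lift ε x (cov (C.push v) x (C.anchor x u)
      + (sg ε / 6) • G.sharpH H x (C.anchor x (G.proj ε x u)) (C.push v x)
      + (sg ε / 2) • G.sharpH H x (C.anchor x (G.proj (-ε) x u)) (C.push v x)) := by
    have : (fun y => C.anchor y (G.proj ε y (v y))) = C.push v :=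
      funext fun y => by rw [G.proj_of_mem (hv y)]; rfl
    simp only [connZeroPart, this, G.proj_of_mem (hv x)]
    rfl
  have h2 : G.connZeroPart cov H (-ε) v x u = 0 := by
    have h0 : (fun y => C.anchor y (G.proj (-ε) y (v y))) = 0 :=
      funext fun y => by rw [G.proj_neg_of_mem (hv y)]; exact map_zero _
    simp only [connZeroPart, h0, cov.zero, G.proj_neg_of_mem (hv x)]
    simp
  have h3 : G.connZero cov H v x u
      = G.connZeroPart cov H ε v x u + G.connZeroPart cov H (-ε) v x u := by
    rcases Int.units_eq_one_or ε with rfl | rfl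
    · rfl
    · rw [neg_neg, add_comm]; rfl
  rw [h3, h2, add_zero, h1]

include hd hdv

lemma conn_of_mem {ε : ℤˣ} {v : ∀ x : M, E x} (hv : ∀ x, v x ∈ G.eig ε x) (x : M) (u : E x) :
    G.conn cov H dv v x u = G.connZero cov H v x u
      + (1 / ((d : ℝ) - 1)) • G.chiMap ε x (G.proj ε x (e x)) u (v x) := by
  rw [conn, LinearMap.add_apply, LinearMap.flip_apply, G.divTensor_apply hd dv e hdv x u (hv x)]

lemma conn_mem {ε : ℤˣ} {v : ∀ x : M, E x} (hv : ∀ x, v x ∈ G.eig ε x) (x : M) (u : E x) :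
    G.conn cov H dv v x u ∈ G.eig ε x := by
  rw [conn, LinearMap.add_apply, G.connZero_of_mem hv]
  exact add_mem (G.lift_mem _ _ _)
    ((G.isDivTensor_divTensor hd dv e hdv x).1.mem u (hv x))

lemma genRiem_conn_mixed {ε : ℤˣ} {a b v w : ∀ x : M, E x} (ha : ∀ x, a x ∈ G.eig ε x)
    (hb : ∀ x, b x ∈ G.eig (-ε) x) (x : M) :
    2 * genRiem C (G.conn cov H dv) a b v w x
      = C.pair x (bareCurv C (G.conn cov H dv) b a v x) (w x) := by
  have hz : ∀ u : E x, u ∈ G.eig (-ε) x → C.pair x u (a x) = 0 := fun u hu => by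
    rw [C.pair_symm, G.pair_eig (ha x) hu]
  have hD : ∀ s : (∀ x : M, E x), (∀ x, s x ∈ G.eig (-ε) x) → ∀ x u,
    G.conn cov H dv s x u ∈ G.eig (-ε) x := fun s hs x u => G.conn_mem hd dv e hdv hs x u
  have h1 : C.pair x (bareCurv C (G.conn cov H dv) v w b x) (a x) = 0 :=
    hz _ (sub_mem (sub_mem (hD _ (fun y => hD b hb y _) x _) (hD _ (fun y => hD b hb y _) x _))
      (hD b hb x _))
  have h2 : trE C x (fun u u' => C.pair x (G.conn cov H dv v x u) (w x) *
      C.pair x (G.conn cov H dv b x u') (a x)) = 0 := by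
    simp only [hz _ (hD b hb x _), mul_zero]
    simpa using trE_const_mul (C := C) x 0 (fun _ _ => 0)
  rw [genRiem, h1, h2]
  ring

end Connection

end GenMetric
end GenGeom

namespace GenGeom

namespace GenMetric

variable {d : ℕ} {M : Type*} [TopologicalSpace M] [ChartedSpace (EuclideanSpace ℝ (Fin d)) M]
  [IsManifold (𝓡 d) ∞ M]
  {F : Type*} [NormedAddCommGroup F] [NormedSpace ℝ F]
  {E : M → Type*} [TopologicalSpace (TotalSpace F E)]
  [∀ x, AddCommGroup (E x)] [∀ x, Module ℝ (E x)] [∀ x, TopologicalSpace (E x)]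
  [FiberBundle F E]
  {C : ExactCourantAlgebroid d F E} (G : GenMetric C)
  [FiniteDimensional ℝ F] [VectorBundle ℝ F E] [T2Space M] [ContMDiffVectorBundle ∞ F E (𝓡 d)]
  {cov : CovariantDerivative (𝓡 d) (EuclideanSpace ℝ (Fin d))
    (TangentSpace (𝓡 d) : M → Type _)}
  {H : ∀ x : M, TangentSpace (𝓡 d) x →ₗ[ℝ] TangentSpace (𝓡 d) x →ₗ[ℝ]
    TangentSpace (𝓡 d) x →ₗ[ℝ] ℝ}

lemma chiMap_mem (ε : ℤˣ) {x : M} {f : E x} (hf : f ∈ G.eig ε x) (u v : E x) :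
    G.chiMap ε x f u v ∈ G.eig ε x :=
  sub_mem (Submodule.smul_mem _ _ hf) (Submodule.smul_mem _ _ (G.proj_mem _ _ _))

lemma chiMap_proj (ε : ℤˣ) {x : M} (f u v : E x) :
    G.chiMap ε x f (G.proj ε x u) v = G.chiMap ε x f u v := by
  simp only [chiMap_apply, G.proj_of_mem (G.proj_mem ε x u)]

lemma chiMap_of_mem_neg {ε : ℤˣ} {x : M} (f : E x) {u : E x} (hu : u ∈ G.eig (-ε) x) (v : E x) :
    G.chiMap ε x f u v = 0 := by
  simp [G.proj_of_mem_neg hu]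

lemma chi_eq {ε : ℤˣ} {f : ∀ x : M, E x} (hf : ∀ x, f x ∈ G.eig ε x) (x : M) (u v w : E x) :
    G.chi ε f x u v w = C.pair x (G.chiMap ε x (f x) u v) w := by
  simp only [chi, chiMap_apply, map_sub, map_smul, LinearMap.sub_apply, LinearMap.smul_apply,
    smul_eq_mul, ← G.pair_proj, G.proj_of_mem (hf x), G.proj_of_mem (G.proj_mem ε x u)]

section

variable (hcov : IsLeviCivita G.metric cov) (hH : G.IsThreeForm H) {ε : ℤˣ}
  {b v w f : ∀ x : M, E x}

/-- `D⁰_b v`, for `b ∈ Γ(E_∓)` and `v ∈ Γ(E_±)`. -/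
lemma connZero_mixed (hb : ∀ x, b x ∈ G.eig (-ε) x) (hv : ∀ x, v x ∈ G.eig ε x) (x : M) :
    G.connZero cov H v x (b x) = G.lift ε x (cov (C.push v) x (C.push b x)
      + (sg ε / 2) • G.sharpH H x (C.push b x) (C.push v x)) := by
  rw [G.connZero_of_mem hv, G.proj_of_mem_neg (hb x), G.proj_of_mem (hb x)]
  simp only [map_zero, LinearMap.zero_apply, smul_zero, add_zero]
  rfl

/-- `D⁰_a v`, for `a, v ∈ Γ(E_±)`. -/
lemma connZero_pure {a : ∀ x : M, E x} (ha : ∀ x, a x ∈ G.eig ε x) (hv : ∀ x, v x ∈ G.eig ε x)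
    (x : M) :
    G.connZero cov H v x (a x) = G.lift ε x (cov (C.push v) x (C.push a x)
      + (sg ε / 6) • G.sharpH H x (C.push a x) (C.push v x)) := by
  rw [G.connZero_of_mem hv, G.proj_neg_of_mem (ha x), G.proj_of_mem (ha x)]
  simp only [map_zero, LinearMap.zero_apply, smul_zero, add_zero]
  rfl

include hcov hH in
/-- The derivative of `χ_±` along `E_∓`, in terms of vector fields. -/
lemma covTensor_chi {a : ∀ x : M, E x} (ha : SmoothSection d F a) (ha' : ∀ x, a x ∈ G.eig ε x)
    (hb : SmoothSection d F b) (hb' : ∀ x, b x ∈ G.eig (-ε) x)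
    (hv : SmoothSection d F v)
    (hw : SmoothSection d F w) (hw' : ∀ x, w x ∈ G.eig ε x)
    (hf : SmoothSection d F f) (hf' : ∀ x, f x ∈ G.eig ε x) (x : M) :
    sg ε * covTensor C (G.connZero cov H) (G.chi ε f) b a v w x =
      G.metric x (cov (fun y => C.anchor y (G.chiMap ε y (f y) (a y) (v y))) x (C.push b x))
          (C.push w x)
        - G.metric x (C.anchor x (G.chiMap ε x (f x) (C.bracket b a x) (v x))) (C.push w x)
        - G.metric x (C.anchor x (G.chiMap ε x (f x) (a x) (G.connZero cov H v x (b x))))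
          (C.push w x)
        - sg ε / 2 * H x (C.push b x) (C.push w x)
          (C.anchor x (G.chiMap ε x (f x) (a x) (v x))) := by
  have hm : ∀ y (u v : E y), G.chiMap ε y (f y) u v ∈ G.eig ε y := fun y u v =>
    G.chiMap_mem ε (hf' y) u v
  have hσ : SmoothField (fun y => C.anchor y (G.chiMap ε y (f y) (a y) (v y))) := by
    refine C.anchor_smooth _ ?_
    simp only [chiMap_apply, G.proj_of_mem (ha' _)]
    exact (hf.smul (C.pair_smooth a v ha hv)).sub (ha.smul (C.pair_smooth f v hf hv))
  have hDa : G.connZero cov H a x (b x) = G.proj ε x (C.bracket b a x) := by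
    rw [G.connZero_mixed hb' ha', ← G.anchor_proj_bracket hcov hH ha ha' hb hb',
      G.lift_anchor (G.proj_mem ε x _)]
  have hmet := hcov.metric (C.push b) _ (C.push w) (C.anchor_smooth b hb) hσ
    (C.anchor_smooth w hw) x
  have hmet' : (fun y => G.metric y (C.anchor y (G.chiMap ε y (f y) (a y) (v y))) (C.push w y))
      = fun y => sg ε * C.pair y (G.chiMap ε y (f y) (a y) (v y)) (w y) :=
    funext fun y => G.metric_anchor (hm y _ _) (hw' y)
  have hs : SmoothFun d (fun y => C.pair y (G.chiMap ε y (f y) (a y) (v y)) (w y)) := by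
    refine C.pair_smooth _ w ?_ hw
    simp only [chiMap_apply, G.proj_of_mem (ha' _)]
    exact (hf.smul (C.pair_smooth a v ha hv)).sub (ha.smul (C.pair_smooth f v hf hv))
  rw [hmet', dirDeriv_const_mul _ _ hs] at hmet
  have hDw : C.push (fun y => G.connZero cov H w y (b y)) x = cov (C.push w) x (C.push b x)
      + (sg ε / 2) • G.sharpH H x (C.push b x) (C.push w x) := by
    rw [ExactCourantAlgebroid.push, G.connZero_mixed hb' hw', G.anchor_lift]
  have k1 := G.metric_anchor (hm x (C.bracket b a x) (v x)) (hw' x)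
  have k2 := G.metric_anchor (hm x (a x) (G.connZero cov H v x (b x))) (hw' x)
  have hDwm : G.connZero cov H w x (b x) ∈ G.eig ε x := by
    rw [G.connZero_mixed hb' hw']; exact G.lift_mem _ _ _
  have k3 := G.metric_anchor (hm x (a x) (v x)) hDwm
  simp only [ExactCourantAlgebroid.push] at hDw
  rw [hDw] at k3
  have k4 := G.metric_sharpH (H := H) x (C.push b x) (C.push w x)
    (C.anchor x (G.chiMap ε x (f x) (a x) (v x)))
  rw [G.metric_symm] at k4
  simp only [map_add, map_smul, smul_eq_mul] at k3
  simp only [covTensor, G.chi_eq hf', hDa, chiMap_proj]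
  unfold ExactCourantAlgebroid.push at *
  rw [k1, k2]
  rw [k4] at k3
  linear_combination hmet + k3

end

end GenMetric

end GenGeom

end

theorem mainTheorem4 {d : ℕ} (hd : d ≠ 1)
    {M : Type*} [TopologicalSpace M] [T2Space M] [SecondCountableTopology M]
    [ChartedSpace (EuclideanSpace ℝ (Fin d)) M] [IsManifold (𝓡 d) ∞ M]
    {F : Type*} [NormedAddCommGroup F] [NormedSpace ℝ F] [FiniteDimensional ℝ F]
    {E : M → Type*} [TopologicalSpace (TotalSpace F E)]
    [∀ x, AddCommGroup (E x)] [∀ x, Module ℝ (E x)] [∀ x, TopologicalSpace (E x)]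
    [FiberBundle F E] [VectorBundle ℝ F E] [ContMDiffVectorBundle ∞ F E (𝓡 d)]
    (C : GenGeom.ExactCourantAlgebroid d F E) (G : GenGeom.GenMetric C)
    -- the Levi-Civita connection `∇` of `g` and the three-form `H`
    (cov : CovariantDerivative (𝓡 d) (EuclideanSpace ℝ (Fin d))
      (TangentSpace (𝓡 d) : M → Type _))
    (hcov : GenGeom.IsLeviCivita G.metric cov)
    (H : ∀ x : M, TangentSpace (𝓡 d) x →ₗ[ℝ] TangentSpace (𝓡 d) x →ₗ[ℝ]
      TangentSpace (𝓡 d) x →ₗ[ℝ] ℝ)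
    (hH : G.IsThreeForm H)
    -- the divergence operator `div = div^𝒢 - ⟨e, ·⟩`
    (dv : GenGeom.DivOperator C) (e : ∀ x : M, E x) (he : GenGeom.SmoothSection d F e)
    (hdv : ∀ v : (∀ x : M, E x), GenGeom.SmoothSection d F v → ∀ x,
      dv.op v x = GenGeom.metricDiv C cov v x - C.pair x (e x) (v x))
    (ε : ℤˣ) (a b v w : ∀ x : M, E x)
    (ha : GenGeom.SmoothSection d F a) (ha' : ∀ x, a x ∈ G.eig ε x)
    (hb : GenGeom.SmoothSection d F b) (hb' : ∀ x, b x ∈ G.eig (-ε) x)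
    (hv : GenGeom.SmoothSection d F v) (hv' : ∀ x, v x ∈ G.eig ε x)
    (hw : GenGeom.SmoothSection d F w) (hw' : ∀ x, w x ∈ G.eig ε x) :
    ∀ x : M,
      GenGeom.sg ε * (2 * GenGeom.genRiem C (G.conn cov H dv) a b v w x) =
        G.riem cov (C.push a) (C.push b) (C.push v) (C.push w) x
        - GenGeom.sg ε * (1 / 2) * GenGeom.covH cov H (C.push a) (C.push b) (C.push v) (C.push w) x
        + GenGeom.sg ε * (1 / 6) * GenGeom.covH cov H (C.push b) (C.push a) (C.push v) (C.push w) x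
        - (1 / 12) * G.H2 H x (C.push b x) (C.push w x) (C.push a x) (C.push v x)
        - (1 / 12) * G.H2 H x (C.push w x) (C.push a x) (C.push b x) (C.push v x)
        - (1 / 6) * G.H2 H x (C.push a x) (C.push b x) (C.push v x) (C.push w x)
        + GenGeom.sg ε * (1 / ((d : ℝ) - 1)) *
          GenGeom.covTensor C (G.connZero cov H)
            (G.chi ε (fun y => G.proj ε y (e y))) b a v w x := by
  intro x
  set c : ℝ := 1 / ((d : ℝ) - 1) with hc
  set f : ∀ x : M, E x := fun y => G.proj ε y (e y) with hfd
  have hf : GenGeom.SmoothSection d F f := G.smooth_proj ε he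
  have hf' : ∀ y, f y ∈ G.eig ε y := fun y => G.proj_mem _ _ _
  have hA : GenGeom.SmoothField (C.push a) := C.anchor_smooth a ha
  have hB : GenGeom.SmoothField (C.push b) := C.anchor_smooth b hb
  have hV : GenGeom.SmoothField (C.push v) := C.anchor_smooth v hv
  have hW : GenGeom.SmoothField (C.push w) := C.anchor_smooth w hw
  have hτ : GenGeom.SmoothField (fun y => C.anchor y (G.chiMap ε y (f y) (a y) (v y))) := by
    refine C.anchor_smooth _ ?_
    simp only [GenGeom.GenMetric.chiMap_apply, G.proj_of_mem (ha' _)]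
    exact (hf.smul (C.pair_smooth a v ha hv)).sub (ha.smul (C.pair_smooth f v hf hv))
  have hσ := hτ.const_smul c
  have hD : ∀ s : (∀ x : M, E x), (∀ x, s x ∈ G.eig ε x) → ∀ y u,
      G.conn cov H dv s y u ∈ G.eig ε y := fun s hs y u => G.conn_mem hd dv e hdv hs y u
  -- the derivatives of sections of `E_±`, as vector fields
  have hmix : ∀ s : (∀ x : M, E x), (∀ x, s x ∈ G.eig ε x) → ∀ y,
      G.conn cov H dv s y (b y) = G.connZero cov H s y (b y) := fun s hs y => by
    rw [G.conn_of_mem hd dv e hdv hs, G.chiMap_of_mem_neg _ (hb' y), smul_zero, add_zero]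
  have hmix' : ∀ s : (∀ x : M, E x), (∀ x, s x ∈ G.eig ε x) → ∀ y,
      C.anchor y (G.conn cov H dv s y (b y)) = cov (C.push s) y (C.push b y)
        + (GenGeom.sg ε / 2) • G.sharpH H y (C.push b y) (C.push s y) := fun s hs y => by
    rw [hmix s hs, G.connZero_mixed hb' hs, G.anchor_lift]
  have hpure : ∀ s : (∀ x : M, E x), (∀ x, s x ∈ G.eig ε x) → ∀ y,
      C.anchor y (G.conn cov H dv s y (a y)) = cov (C.push s) y (C.push a y)
        + (GenGeom.sg ε / 6) • G.sharpH H y (C.push a y) (C.push s y)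
        + c • C.anchor y (G.chiMap ε y (f y) (a y) (s y)) := fun s hs y => by
    rw [G.conn_of_mem hd dv e hdv hs, G.connZero_pure ha' hs, map_add, G.anchor_lift, map_smul]
  have hp : C.push (fun y => G.conn cov H dv v y (a y)) = fun y => cov (C.push v) y (C.push a y)
        + (GenGeom.sg ε / 6) • G.sharpH H y (C.push a y) (C.push v y)
        + c • C.anchor y (G.chiMap ε y (f y) (a y) (v y)) := funext fun y => hpure v hv' y
  have hq : C.push (fun y => G.conn cov H dv v y (b y)) = fun y => cov (C.push v) y (C.push b y)
        + (GenGeom.sg ε / 2) • G.sharpH H y (C.push b y) (C.push v y) := funext fun y => hmix' v hv' y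
  have t1 := hmix' (fun y => G.conn cov H dv v y (a y)) (fun y => hD v hv' y _) x
  have t2 := hpure (fun y => G.conn cov H dv v y (b y)) (fun y => hD v hv' y _) x
  rw [hp] at t1
  rw [hq, hmix v hv'] at t2
  have t3 : C.anchor x (G.conn cov H dv v x (C.bracket b a x)) =
      cov (C.push v) x (VectorField.mlieBracket (𝓡 d) (C.push b) (C.push a) x)
        + (GenGeom.sg ε / 6) • G.sharpH H x (cov (C.push a) x (C.push b x)
            + (GenGeom.sg ε / 2) • G.sharpH H x (C.push b x) (C.push a x)) (C.push v x)
        + (GenGeom.sg ε / 2) • G.sharpH H x (-(cov (C.push b) x (C.push a x)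
            + (GenGeom.sg ε / 2) • G.sharpH H x (C.push b x) (C.push a x))) (C.push v x)
        + c • C.anchor x (G.chiMap ε x (f x) (C.bracket b a x) (v x)) := by
    rw [G.conn_of_mem hd dv e hdv hv', G.connZero_of_mem hv', map_add, G.anchor_lift, map_smul,
      G.anchor_proj_bracket hcov hH ha ha' hb hb', G.anchor_proj_neg_bracket hcov hH ha ha' hb hb',
      C.anchor_bracket b a hb ha]
    rfl
  have hbare : GenGeom.bareCurv C (G.conn cov H dv) b a v x ∈ G.eig ε x :=
    sub_mem (sub_mem (hD _ (fun y => hD v hv' y _) x _) (hD _ (fun y => hD v hv' y _) x _))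
      (hD v hv' x _)
  have hanch : C.anchor x (GenGeom.bareCurv C (G.conn cov H dv) b a v x) = _ :=
    (map_sub _ _ _).trans (congrArg₂ (· - ·) ((map_sub _ _ _).trans
      (congrArg₂ (· - ·) t1 t2)) t3)
  have key := G.metric_mixed_curvature hcov hH (GenGeom.sg_mul_self ε) hA hB hV hW hσ x
  have hχ := G.covTensor_chi hcov hH ha ha' hb hb' hv hw hw' hf hf' x
  rw [G.genRiem_conn_mixed hd dv e hdv ha' hb' x, ← G.metric_anchor hbare (hw' x), hanch,
    G.riem_swap hcov ha hb hv hw]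
  rw [GenGeom.cov_const_smul cov c hτ] at key
  simp only [map_add, map_sub, map_smul, LinearMap.add_apply, LinearMap.sub_apply,
    LinearMap.smul_apply, _root_.smul_apply, smul_eq_mul] at key ⊢
  unfold GenGeom.ExactCourantAlgebroid.push at *
  linear_combination key - c * hχ
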